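/- Let $k$ be an algebraically closed field, $n\ge 1$ and $V=k^n$. Let $\mathcal F$ be the variety of $n$-step flags $0=V_0\subseteq V_1\subseteq\cdots\subseteq V_n=V$ (inclusions not necessarily strict). The group $\mathrm{GL}(V)$ acts diagonally on $\mathcal F\times\mathcal F$; write $[f,f']$ for the orbit of $(f,f')$. Let $G(n,n)$ be the free $\mathbb Z$-module on the set of these orbits, with the $\mathbb Z$-bilinear product $\star$ defined on orbits $e,e'$ as follows: let $S(e,e')=\{(p_1,p_3)\mid \exists\, p_2\in\mathcal F:\ (p_1,p_2)\in e,\ (p_2,p_3)\in e'\}$; then $e\star e'$ is the unique orbit that is open in $S(e,e')$ (in the Zariski topology) if $S(e,e')\neq\emptyset$, and $e\star e'=0$ if $S(e,e')=\emptyset$. Let $x_1,\dots,x_n$ be the standard basis of $V$ and let $h$ be the complete flag with $h_i=\langle x_1,\dots,x_i\rangle$. Put $k_{\underline d}=[h,h]$ (here $\underline d=(1,\dots,1)$) and $H_0(n)=k_{\underline d}\star G(n,n)\star k_{\underline d}$, which is an associative ring with identity $k_{\underline d}$. For a permutation $\sigma\in S_n$ let $\sigma k_{\underline d}=[h^\sigma,h]$,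 where $h^\sigma$ is the flag with $h^\sigma_i=\langle x_l\mid \sigma(l)\le i\rangle$, and let $t_i=(i,i+1)k_{\underline d}$ for $1\le i<n$. For $\sigma\in S_n$ define inductively $\tau_0=1$ and, for $i=1,\dots,n$, $$t^{\sigma,i}=t_i\star t_{i+1}\star\cdots\star t_{\tau_{i-1}(\sigma^{-1}(i))-1},$$ an empty product being $k_{\underline d}$, where $\tau_i\in S_n$ is the permutation with $\tau_i k_{\underline d}=t^{\sigma,i}\star\cdots\star t^{\sigma,1}$; this permutation exists and is unique. Put $t^\sigma=t^{\sigma,n}\star\cdots\star t^{\sigma,1}$. Then $t^\sigma=\sigma k_{\underline d}$ for every $\sigma\in S_n$. Consequently, the elements $t^\sigma$, $\sigma\in S_n$, form a multiplicative basis of $H_0(n)$: they are a $\mathbb Z$-basis of $H_0(n)$, and the product of any two of them is again one of them or zero. -/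

import Mathlib

/-- The Zariski topology on the affine space `k ^ ι`: it is generated by the (basic open)
non-vanishing sets of polynomials. -/
abbrev zariskiAffine (ι k : Type*) [CommRing k] : TopologicalSpace (ι → k) :=
  TopologicalSpace.generateFrom
    {U | ∃ p : MvPolynomial ι k, U = {x | MvPolynomial.eval x p ≠ 0}}

section Flags

variable (k : Type*) [Field k] (n r : ℕ)

/-- `n`-step flags `0 = V₀ ⊆ V₁ ⊆ ⋯ ⊆ Vₙ = V` in the `r`-dimensional space `V = k ^ r`
(the inclusions need not be strict). -/
@[ext]
structure StepFlag where
  space : Fin (n + 1) → Submodule k (Fin r → k)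
  mono' : Monotone space
  zero' : space 0 = ⊥
  last' : space (Fin.last n) = ⊤

end Flags

section Geometry

variable {k : Type*} [Field k] {n r : ℕ}

/-- The group `GL(V)` acts on flags by change of basis: `(g • f)ᵢ = g (fᵢ)`. -/
instance StepFlag.mulActionGL :
    MulAction (Matrix.GeneralLinearGroup (Fin r) k) (StepFlag k n r) where
  smul g f :=
    { space := fun i => (f.space i).map (Matrix.toLin' (g : Matrix (Fin r) (Fin r) k))
      mono' := fun _ _ h => Submodule.map_mono (f.mono' h)
      zero' := by rw [f.zero', Submodule.map_bot]
      last' := by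
        rw [f.last', Submodule.map_top, LinearMap.range_eq_top]
        intro y
        refine ⟨Matrix.toLin' ((g⁻¹ : Matrix.GeneralLinearGroup (Fin r) k) :
          Matrix (Fin r) (Fin r) k) y, ?_⟩
        rw [← LinearMap.comp_apply, ← Matrix.toLin'_mul, ← Units.val_mul, mul_inv_cancel,
          Units.val_one, Matrix.toLin'_one, LinearMap.id_apply] }
  one_smul f := by
    apply StepFlag.ext
    funext i
    change (f.space i).map (Matrix.toLin' (1 : Matrix (Fin r) (Fin r) k)) = f.space i
    rw [Matrix.toLin'_one, Submodule.map_id]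
  mul_smul g h f := by
    apply StepFlag.ext
    funext i
    change (f.space i).map (Matrix.toLin' ((g : Matrix (Fin r) (Fin r) k) *
        (h : Matrix (Fin r) (Fin r) k))) =
      ((f.space i).map (Matrix.toLin' (h : Matrix (Fin r) (Fin r) k))).map
        (Matrix.toLin' (g : Matrix (Fin r) (Fin r) k))
    rw [Matrix.toLin'_mul, Submodule.map_comp]

end Geometry

section GenericAlgebra

variable (k : Type*) [Field k] (n r : ℕ)

/-- The set of `GL(V)`-orbits in `ℱ × ℱ` under the diagonal action. -/
abbrev FlagPairOrbit : Type _ :=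
  MulAction.orbitRel.Quotient (Matrix.GeneralLinearGroup (Fin r) k)
    (StepFlag k n r × StepFlag k n r)

/-- The Zariski topology on `GL(V) × GL(V)`, as a subspace of the affine space of pairs of
matrices. -/
abbrev zariskiGLGL : TopologicalSpace
    (Matrix.GeneralLinearGroup (Fin r) k × Matrix.GeneralLinearGroup (Fin r) k) :=
  TopologicalSpace.induced
    (fun g => (Sum.elim (fun ij => (g.1 : Matrix (Fin r) (Fin r) k) ij.1 ij.2)
      (fun ij => (g.2 : Matrix (Fin r) (Fin r) k) ij.1 ij.2) :
        (Fin r × Fin r) ⊕ (Fin r × Fin r) → k))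
    (zariskiAffine ((Fin r × Fin r) ⊕ (Fin r × Fin r)) k)

/-- The Zariski topology on `ℱ × ℱ`. The variety `ℱ × ℱ` is the disjoint union of its finitely
many components `ℱ_d × ℱ_e`; each is a homogeneous space of `GL(V) × GL(V)`, isomorphic to
`(GL(V) × GL(V)) / (P × P')` with parabolics `P`, `P'`, and carries the quotient topology. So a
set is open iff all its preimages under the orbit maps `(g, g') ↦ (g f, g' f')` are open. -/
abbrev zariskiFlagPair : TopologicalSpace (StepFlag k n r × StepFlag k n r) :=
  ⨆ p : StepFlag k n r × StepFlag k n r,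
    TopologicalSpace.coinduced
      (fun g : Matrix.GeneralLinearGroup (Fin r) k × Matrix.GeneralLinearGroup (Fin r) k =>
        (g.1 • p.1, g.2 • p.2))
      (zariskiGLGL k r)

variable {k n r}

/-- The orbit `[f, f']`. -/
def flagPairOrbit (f f' : StepFlag k n r) : FlagPairOrbit k n r :=
  Quotient.mk'' (f, f')

/-- `S(A, A') = π Δ⁻¹ (e_A × e_{A'})`: the pairs `(p₁, p₃)` for which there is a flag `p₂` with
`(p₁, p₂)` in the first and `(p₂, p₃)` in the second orbit. -/
def orbitProductSet (A A' : FlagPairOrbit k n r) : Set (StepFlag k n r × StepFlag k n r) :=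
  {p | ∃ f : StepFlag k n r, (p.1, f) ∈ A.orbit ∧ (f, p.2) ∈ A'.orbit}

/-- `C` is an orbit contained in `S` which is open in `S` for the subspace topology. -/
def IsOpenOrbitIn (C : FlagPairOrbit k n r) (S : Set (StepFlag k n r × StepFlag k n r)) : Prop :=
  ∃ U : Set (StepFlag k n r × StepFlag k n r), @IsOpen _ (zariskiFlagPair k n r) U ∧ U ∩ S = C.orbit

variable (k n r) in
/-- The underlying `ℤ`-module of the generic algebra `G(n, r)`: the free `ℤ`-module on the set of
orbits of pairs of flags. -/
def GenericAlgebra : Type _ := FlagPairOrbit k n r →₀ ℤ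

noncomputable instance : AddCommGroup (GenericAlgebra k n r) :=
  inferInstanceAs (AddCommGroup (FlagPairOrbit k n r →₀ ℤ))

/-- An orbit, as a basis element of `G(n, r)`. -/
noncomputable def orbitElt (A : FlagPairOrbit k n r) : GenericAlgebra k n r :=
  (Finsupp.single A (1 : ℤ) : FlagPairOrbit k n r →₀ ℤ)

open Classical in
/-- The product `e_A ⋆ e_{A'}`: the open orbit of `S(A, A')`; it is `0` if there is none, that is,
if `S(A, A')` is empty. -/
noncomputable def orbitStar (A A' : FlagPairOrbit k n r) : GenericAlgebra k n r :=
  if h : ∃ C, IsOpenOrbitIn C (orbitProductSet A A') then orbitElt h.choose else 0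

/-- The `ℤ`-bilinear extension of `⋆` to `G(n, r)`. -/
noncomputable def starBilin :
    GenericAlgebra k n r →ₗ[ℤ] GenericAlgebra k n r →ₗ[ℤ] GenericAlgebra k n r :=
  Finsupp.lift (GenericAlgebra k n r →ₗ[ℤ] GenericAlgebra k n r) ℤ (FlagPairOrbit k n r)
    (fun A => Finsupp.lift (GenericAlgebra k n r) ℤ (FlagPairOrbit k n r)
      (fun A' => orbitStar A A'))

/-- The multiplication `⋆` of `G(n, r)`. -/
noncomputable instance : NonUnitalNonAssocRing (GenericAlgebra k n r) where
  mul x y := starBilin x y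
  left_distrib x y z := map_add (starBilin x) y z
  right_distrib x y z := by
    change starBilin (x + y) z = starBilin x z + starBilin y z
    rw [map_add, LinearMap.add_apply]
  zero_mul x := by
    change starBilin 0 x = 0
    rw [map_zero, LinearMap.zero_apply]
  mul_zero x := map_zero (starBilin x)

theorem orbitElt_mul_orbitElt (A A' : FlagPairOrbit k n r) :
    orbitElt A * orbitElt A' = orbitStar A A' := by
  have h1 : starBilin (orbitElt A) = _ :=
    congrFun ((Finsupp.lift (GenericAlgebra k n r →ₗ[ℤ] GenericAlgebra k n r) ℤ
      (FlagPairOrbit k n r)).symm_apply_apply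
        (fun A => Finsupp.lift (GenericAlgebra k n r) ℤ (FlagPairOrbit k n r)
          (fun A' => orbitStar A A'))) A
  have h2 := congrFun ((Finsupp.lift (GenericAlgebra k n r) ℤ
    (FlagPairOrbit k n r)).symm_apply_apply (fun A' => orbitStar A A')) A'
  exact (congrArg (fun L => L (orbitElt A')) h1).trans h2

end GenericAlgebra

section Abstract

variable {R : Type*} [NonUnitalNonAssocRing R]

/-- The subgroup `e R e`. -/
def corner (e : R) : Submodule ℤ R :=
  LinearMap.range (AddMonoidHom.toIntLinearMap
    ((AddMonoidHom.mulRight e).comp (AddMonoidHom.mulLeft e)))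

/-- `H` is an associative `ℤ`-algebra with identity `e` under the multiplication of `R`. -/
structure IsUnitalAssocAlgebra (H : Submodule ℤ R) (e : R) : Prop where
  one_mem : e ∈ H
  mul_mem : ∀ x ∈ H, ∀ y ∈ H, x * y ∈ H
  one_mul : ∀ x ∈ H, e * x = x
  mul_one : ∀ x ∈ H, x * e = x
  mul_assoc : ∀ x ∈ H, ∀ y ∈ H, ∀ z ∈ H, x * y * z = x * (y * z)

/-- The family `b` is a multiplicative `ℤ`-basis of `H`: a basis of `H` such that the product of
any two basis elements is a basis element or zero. -/
structure IsMultiplicativeBasis (H : Submodule ℤ R) {ι : Type*} (b : ι → R) : Prop where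
  linearIndependent : LinearIndependent ℤ b
  span_eq : Submodule.span ℤ (Set.range b) = H
  mul_mem : ∀ i j, b i * b j = 0 ∨ ∃ l, b i * b j = b l

end Abstract

section Hecke

variable {k : Type*} [Field k] {n r : ℕ}

/-- The flag in `k ^ r` whose `i`-th space is spanned by the standard basis vectors `e_l` with
`c l ≤ i` (for `c l` numbered from `1`, as are the steps; here `c l : Fin n` is numbered from `0`).
The representation `⨁ₗ N_{iₗ jₗ}` is the pair `(coordFlag i, coordFlag j)`. -/
def coordFlag (c : Fin r → Fin n) : StepFlag k n r where
  space i := Submodule.span k {v | ∃ l, (c l : ℕ) < (i : ℕ) ∧ v = Pi.single l 1}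
  mono' := by
    intro i j h
    apply Submodule.span_mono
    rintro v ⟨l, hl, rfl⟩
    exact ⟨l, lt_of_lt_of_le hl h, rfl⟩
  zero' := by
    rw [Submodule.span_eq_bot]
    rintro v ⟨l, hl, -⟩
    simp at hl
  last' := by
    rw [eq_top_iff, ← (Pi.basisFun k (Fin r)).span_eq]
    apply Submodule.span_mono
    rintro v ⟨l, rfl⟩
    exact ⟨l, by simp, by simp⟩

variable (k n) in
/-- `k_d = [h, h]` for `d = (1, …, 1)`, with `h` the standard complete flag. -/
noncomputable def kOne : GenericAlgebra k n n :=
  orbitElt (flagPairOrbit (coordFlag id) (coordFlag id))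

variable (k n) in
/-- `H₀(n) = k_d G(n, n) k_d`. -/
noncomputable def zeroHecke : Submodule ℤ (GenericAlgebra k n n) := corner (kOne k n)

variable (k) in
/-- `σ k_d`, the orbit of the representation `⨁ₗ N_{σ(l), l}`. -/
noncomputable def permOrbit (σ : Equiv.Perm (Fin n)) : GenericAlgebra k n n :=
  orbitElt (flagPairOrbit (coordFlag σ) (coordFlag id))

variable (k n) in
/-- `tᵢ = (i, i+1) k_d`, where `i` and `i + 1` are elements of `{0, …, n - 1}`
(and the irrelevant value `0` for other `i`). -/
noncomputable def tGen (i : ℕ) : GenericAlgebra k n n :=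
  if h : i + 1 < n then permOrbit k (Equiv.swap ⟨i, Nat.lt_of_succ_lt h⟩ ⟨i + 1, h⟩) else 0

variable (k n) in
/-- The product `tᵢ ⋆ tᵢ₊₁ ⋆ ⋯ ⋆ tⱼ₋₁`; an empty product is the identity `k_d` of `H₀(n)`. -/
noncomputable def tInterval (i j : ℕ) : GenericAlgebra k n n :=
  ((List.range' i (j - i)).map (tGen k n)).foldr (fun x y => x * y) (kOne k n)

open Classical in
/-- The permutation `τ` with `τ k_d = x` (the irrelevant value `1` if there is none). -/
noncomputable def permOf (x : GenericAlgebra k n n) : Equiv.Perm (Fin n) :=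
  if h : ∃ τ : Equiv.Perm (Fin n), permOrbit k τ = x then h.choose else 1

variable (k) in
/-- The partial products `t^{σ,i} ⋆ ⋯ ⋆ t^{σ,1}`, for `i = 0, …, n`. Here
`t^{σ,i} = tᵢ ⋆ ⋯ ⋆ t_{τ(σ⁻¹(i)) - 1}`, where `τ = τᵢ₋₁` is the permutation with
`τ k_d = t^{σ,i-1} ⋆ ⋯ ⋆ t^{σ,1}` (so `τ₀ = 1`). -/
noncomputable def tPartial (σ : Equiv.Perm (Fin n)) : ℕ → GenericAlgebra k n n
  | 0 => kOne k n
  | i + 1 =>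
    if h : i < n then
      tInterval k n i (permOf (tPartial σ i) (σ⁻¹ ⟨i, h⟩)) * tPartial σ i
    else tPartial σ i

variable (k) in
/-- `t^σ = t^{σ,n} ⋆ ⋯ ⋆ t^{σ,1}`. -/
noncomputable def tPerm (σ : Equiv.Perm (Fin n)) : GenericAlgebra k n n := tPartial k σ n

end Hecke

/-! The orbit of a pair of complete flags is its relative position, recorded by the dimensions of
the intersections `f i ⊓ f' j`. By the Bruhat decomposition (`exists_eq_smul_coordFlag`) these
orbits are exactly the `σ k_d`, and the dimensions determine `σ`. The dimensions are upper
semicontinuous (`isOpen_flagRank_le`), so "position at most that of `q`" is an open condition.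

The set `S(A, A')` is irreducible: two of its points lie on a family of flags given by polynomial
matrices, a nonempty open condition holds at all but finitely many parameters, and `k` is infinite
(`orbitProductSet_irreducible`). Hence the positions occurring in `S(A, A')` have a least one, and
for complete flags its orbit is the open orbit (`orbitElt_mul_eq_of_minimal`). A product of
permutation orbits is therefore again a permutation orbit. Applying the same argument to chains of
four flags gives associativity. Multiplication by `k_d` fixes or kills each orbit according to
completeness, so `H₀(n)` is the span of the `σ k_d`.

It remains to compute `t^σ`. If left multiplication by `(i, i+1)` increases the length of `w`, then
`⋆` is the product of permutations (`permOrbit_swap_mul`). The construction of `t^σ` is an insertion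
procedure: stage `i` slides one value down to `i`, past values standing to its left, so that every
step increases the length. After `n` stages the permutation is `σ`. -/

open Polynomial in
-- Nonvanishing sets are closed under finite intersection, because polynomials can be multiplied, so
-- the generating family is already a base of the topology.
theorem zariskiAffine_exists_polynomial {ι k : Type*} [Field k] {V : Set (ι → k)}
    (hV : @IsOpen _ (zariskiAffine ι k) V) {x : ι → k} (hx : x ∈ V) :
    ∃ P : MvPolynomial ι k, MvPolynomial.eval x P ≠ 0 ∧ ∀ y, MvPolynomial.eval y P ≠ 0 → y ∈ V := by
  induction hV with
  | basic s hs =>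
    obtain ⟨p, rfl⟩ := hs
    exact ⟨p, hx, fun y hy => hy⟩
  | univ => exact ⟨1, by simp, fun _ _ => trivial⟩
  | inter s t _ _ ihs iht =>
    obtain ⟨P, hP, hPs⟩ := ihs hx.1
    obtain ⟨Q, hQ, hQt⟩ := iht hx.2
    refine ⟨P * Q, by rw [map_mul]; exact mul_ne_zero hP hQ, fun y hy => ?_⟩
    rw [map_mul] at hy
    exact ⟨hPs y (left_ne_zero_of_mul hy), hQt y (right_ne_zero_of_mul hy)⟩
  | sUnion S _ ih =>
    obtain ⟨s, hs, hxs⟩ := hx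
    obtain ⟨P, hP, hPs⟩ := ih s hs hxs
    exact ⟨P, hP, fun y hy => ⟨s, hs, hPs y hy⟩⟩

/-! ### Relative position of two flags and its semicontinuity -/

section RelativePosition

variable {k : Type*} [Field k] {n r : ℕ}

/-- The relative position of two flags: the dimensions of the intersections of their steps. -/
noncomputable def flagRank (p : StepFlag k n r × StepFlag k n r) (i j : Fin (n + 1)) : ℕ :=
  Module.finrank k ↥(p.1.space i ⊓ p.2.space j)

theorem toLin'_GL_injective (g : Matrix.GeneralLinearGroup (Fin r) k) :
    Function.Injective (Matrix.toLin' (g : Matrix (Fin r) (Fin r) k)) := by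
  apply Function.LeftInverse.injective
    (g := Matrix.toLin' ((g⁻¹ : Matrix.GeneralLinearGroup (Fin r) k) : Matrix (Fin r) (Fin r) k))
  intro x
  rw [← LinearMap.comp_apply, ← Matrix.toLin'_mul, ← Units.val_mul, inv_mul_cancel,
    Units.val_one, Matrix.toLin'_one, LinearMap.id_apply]

theorem StepFlag.smul_space (g : Matrix.GeneralLinearGroup (Fin r) k) (f : StepFlag k n r)
    (i : Fin (n + 1)) :
    (g • f).space i = (f.space i).map (Matrix.toLin' (g : Matrix (Fin r) (Fin r) k)) := rfl

theorem StepFlag.finrank_smul_space (g : Matrix.GeneralLinearGroup (Fin r) k)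
    (f : StepFlag k n r) (i : Fin (n + 1)) :
    Module.finrank k ((g • f).space i) = Module.finrank k (f.space i) :=
  (Submodule.equivMapOfInjective _ (toLin'_GL_injective g) _).finrank_eq.symm

theorem flagRank_smul (g : Matrix.GeneralLinearGroup (Fin r) k)
    (p : StepFlag k n r × StepFlag k n r) : flagRank (g • p) = flagRank p := by
  funext i j
  unfold flagRank
  rw [Prod.smul_fst, Prod.smul_snd, StepFlag.smul_space, StepFlag.smul_space,
    ← Submodule.map_inf _ (toLin'_GL_injective g)]
  exact (Submodule.equivMapOfInjective _ (toLin'_GL_injective g) _).finrank_eq.symm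

theorem mem_orbit_flagPairOrbit {p : StepFlag k n r × StepFlag k n r} {f f' : StepFlag k n r} :
    p ∈ (flagPairOrbit f f').orbit ↔
      ∃ g : Matrix.GeneralLinearGroup (Fin r) k, p = (g • f, g • f') := by
  rw [flagPairOrbit, MulAction.orbitRel.Quotient.orbit_mk]
  constructor
  · rintro ⟨g, rfl⟩
    exact ⟨g, rfl⟩
  · rintro ⟨g, rfl⟩
    exact ⟨g, rfl⟩

theorem mem_orbit_iff_flagPairOrbit_eq {f f' : StepFlag k n r} {A : FlagPairOrbit k n r} :
    (f, f') ∈ A.orbit ↔ flagPairOrbit f f' = A :=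
  MulAction.orbitRel.Quotient.mem_orbit

theorem flagRank_eq_of_mem_orbit {p q : StepFlag k n r × StepFlag k n r}
    {A : FlagPairOrbit k n r} (hp : p ∈ A.orbit) (hq : q ∈ A.orbit) :
    flagRank p = flagRank q := by
  obtain ⟨f, f'⟩ := q
  rw [mem_orbit_iff_flagPairOrbit_eq] at hq
  rw [← hq, mem_orbit_flagPairOrbit] at hp
  obtain ⟨g, rfl⟩ := hp
  exact flagRank_smul g (f, f')

theorem smul_mem_orbit {p : StepFlag k n r × StepFlag k n r} {A : FlagPairOrbit k n r}
    (hp : p ∈ A.orbit) (g : Matrix.GeneralLinearGroup (Fin r) k) : g • p ∈ A.orbit := by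
  obtain ⟨f, f'⟩ := p
  rw [mem_orbit_iff_flagPairOrbit_eq] at hp
  rw [← hp, mem_orbit_flagPairOrbit]
  exact ⟨g, rfl⟩

theorem exists_smul_of_mem_orbit {p q : StepFlag k n r × StepFlag k n r}
    {A : FlagPairOrbit k n r} (hp : p ∈ A.orbit) (hq : q ∈ A.orbit) :
    ∃ g : Matrix.GeneralLinearGroup (Fin r) k, q = g • p := by
  obtain ⟨f, f'⟩ := p
  rw [mem_orbit_iff_flagPairOrbit_eq] at hp
  rw [← hp, mem_orbit_flagPairOrbit] at hq
  exact hq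

/-- If `g F + g' F'` has dimension `e` at `g₀`, then it has dimension at least `e` on a
neighbourhood. -/
theorem exists_isOpen_le_finrank_sup (F F' : Submodule k (Fin r → k))
    (g₀ : Matrix.GeneralLinearGroup (Fin r) k × Matrix.GeneralLinearGroup (Fin r) k) :
    ∃ U : Set (Matrix.GeneralLinearGroup (Fin r) k × Matrix.GeneralLinearGroup (Fin r) k),
      @IsOpen _ (zariskiGLGL k r) U ∧ g₀ ∈ U ∧ ∀ g ∈ U,
        Module.finrank k ↥(F.map (Matrix.toLin' (g₀.1 : Matrix (Fin r) (Fin r) k)) ⊔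
          F'.map (Matrix.toLin' (g₀.2 : Matrix (Fin r) (Fin r) k))) ≤
        Module.finrank k ↥(F.map (Matrix.toLin' (g.1 : Matrix (Fin r) (Fin r) k)) ⊔
          F'.map (Matrix.toLin' (g.2 : Matrix (Fin r) (Fin r) k))) := by
  set W := F.map (Matrix.toLin' (g₀.1 : Matrix (Fin r) (Fin r) k)) ⊔
          F'.map (Matrix.toLin' (g₀.2 : Matrix (Fin r) (Fin r) k)) with hW
  let u := Module.finBasis k W
  have hu : ∀ i, ∃ x ∈ F, ∃ y ∈ F', (g₀.1 : Matrix (Fin r) (Fin r) k).mulVec x +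
      (g₀.2 : Matrix (Fin r) (Fin r) k).mulVec y = (u i : Fin r → k) := by
    intro i
    obtain ⟨a, ha, b, hb, hab⟩ := Submodule.mem_sup.1 (u i).2
    obtain ⟨x, hx, rfl⟩ := Submodule.mem_map.1 ha
    obtain ⟨y, hy, rfl⟩ := Submodule.mem_map.1 hb
    exact ⟨x, hx, y, hy, by simpa using hab⟩
  choose x hx y hy hxy using hu
  obtain ⟨π, hπ⟩ := W.subtype.exists_leftInverse_of_injective W.ker_subtype
  -- `L` reads off coordinates in the basis `u`, so the matrix of the images `L (g x_j + g' y_j)` is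
  -- the identity at `g₀`. Its determinant is a polynomial in the entries of the two matrices;
  -- wherever it is nonzero, the vectors `g x_j + g' y_j` stay independent.
  let L : (Fin r → k) →ₗ[k] (Fin (Module.finrank k W) → k) := u.equivFun.toLinearMap ∘ₗ π
  have hL : ∀ j, L (u j) = Pi.single j 1 := by
    intro j
    have : π (u j) = u j := LinearMap.congr_fun hπ (u j)
    simp only [L, LinearMap.comp_apply, this]
    ext i
    simp [Pi.single_apply, eq_comm]
  let T : Matrix (Fin (Module.finrank k W)) (Fin (Module.finrank k W))
      (MvPolynomial ((Fin r × Fin r) ⊕ (Fin r × Fin r)) k) := Matrix.of fun i j =>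
    ∑ a, MvPolynomial.C (LinearMap.toMatrix' L i a) *
      (∑ b, MvPolynomial.X (Sum.inl (a, b)) * MvPolynomial.C (x j b) +
        ∑ b, MvPolynomial.X (Sum.inr (a, b)) * MvPolynomial.C (y j b))
  have hT : ∀ g : Matrix.GeneralLinearGroup (Fin r) k × Matrix.GeneralLinearGroup (Fin r) k,
      MvPolynomial.eval (Sum.elim (fun ij => (g.1 : Matrix (Fin r) (Fin r) k) ij.1 ij.2)
        (fun ij => (g.2 : Matrix (Fin r) (Fin r) k) ij.1 ij.2)) T.det =
      (Matrix.of fun i j => L ((g.1 : Matrix (Fin r) (Fin r) k).mulVec (x j) +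
        (g.2 : Matrix (Fin r) (Fin r) k).mulVec (y j)) i).det := by
    intro g
    rw [RingHom.map_det]
    congr 1
    ext i j
    rw [Matrix.of_apply, ← LinearMap.toMatrix'_mulVec L]
    simp [T, Matrix.mulVec, dotProduct]
  refine ⟨{g | MvPolynomial.eval (Sum.elim (fun ij => (g.1 : Matrix (Fin r) (Fin r) k) ij.1 ij.2)
        (fun ij => (g.2 : Matrix (Fin r) (Fin r) k) ij.1 ij.2)) T.det ≠ 0},
    (@isOpen_induced_iff _ _ (zariskiAffine _ k) _ _).2 ⟨_, TopologicalSpace.GenerateOpen.basic _ ⟨T.det, rfl⟩, rfl⟩, ?_, ?_⟩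
  · change _ ≠ _
    rw [hT]
    have : (Matrix.of fun i j => L ((g₀.1 : Matrix (Fin r) (Fin r) k).mulVec (x j) +
        (g₀.2 : Matrix (Fin r) (Fin r) k).mulVec (y j)) i) = 1 := by
      ext i j
      rw [Matrix.of_apply, hxy, hL, Matrix.one_apply, Pi.single_apply]
    rw [this, Matrix.det_one]
    exact one_ne_zero
  · intro g hg
    change _ ≠ _ at hg
    rw [hT] at hg
    have h1 := Matrix.linearIndependent_cols_of_det_ne_zero hg
    have h2 : LinearIndependent k (fun j => (g.1 : Matrix (Fin r) (Fin r) k).mulVec (x j) +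
        (g.2 : Matrix (Fin r) (Fin r) k).mulVec (y j)) := LinearIndependent.of_comp L h1
    have h3 : Submodule.span k (Set.range fun j => (g.1 : Matrix (Fin r) (Fin r) k).mulVec (x j) +
        (g.2 : Matrix (Fin r) (Fin r) k).mulVec (y j)) ≤
        F.map (Matrix.toLin' (g.1 : Matrix (Fin r) (Fin r) k)) ⊔
          F'.map (Matrix.toLin' (g.2 : Matrix (Fin r) (Fin r) k)) := by
      rw [Submodule.span_le]
      rintro _ ⟨j, rfl⟩
      exact Submodule.add_mem_sup ⟨x j, hx j, by simp⟩ ⟨y j, hy j, by simp⟩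
    have h4 := Submodule.finrank_mono h3
    rwa [finrank_span_eq_card h2, Fintype.card_fin] at h4

/-- The dimensions of sum and intersection add up to a constant along each `GL × GL` orbit, and the
dimension of the sum can only grow nearby; so that of the intersection can only drop. -/
theorem isOpen_flagRank_le (i j : Fin (n + 1)) (c : ℕ) :
    @IsOpen _ (zariskiFlagPair k n r) {p | flagRank p i j ≤ c} := by
  rw [isOpen_iSup_iff]
  intro p
  rw [isOpen_coinduced]
  let _ := zariskiGLGL k r
  rw [isOpen_iff_forall_mem_open]
  intro g₀ hg₀
  obtain ⟨U, hU, hgU, h⟩ := exists_isOpen_le_finrank_sup (p.1.space i) (p.2.space j) g₀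
  refine ⟨U, fun g hg => ?_, hU, hgU⟩
  have key : ∀ g : Matrix.GeneralLinearGroup (Fin r) k × Matrix.GeneralLinearGroup (Fin r) k,
      Module.finrank k ↥((p.1.space i).map (Matrix.toLin' (g.1 : Matrix (Fin r) (Fin r) k)) ⊔
          (p.2.space j).map (Matrix.toLin' (g.2 : Matrix (Fin r) (Fin r) k))) +
        flagRank (g.1 • p.1, g.2 • p.2) i j =
        Module.finrank k (p.1.space i) + Module.finrank k (p.2.space j) := by
    intro g
    rw [← StepFlag.finrank_smul_space g.1 p.1 i, ← StepFlag.finrank_smul_space g.2 p.2 j]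
    exact Submodule.finrank_sup_add_finrank_inf_eq _ _
  have h1 := key g₀
  have h2 := key g
  have h3 := h g hg
  change flagRank (g₀.1 • p.1, g₀.2 • p.2) i j ≤ c at hg₀
  change flagRank (g.1 • p.1, g.2 • p.2) i j ≤ c
  omega

theorem isOpen_flagRank_le_flagRank (q : StepFlag k n r × StepFlag k n r) :
    @IsOpen _ (zariskiFlagPair k n r) {p | flagRank p ≤ flagRank q} := by
  have : {p : StepFlag k n r × StepFlag k n r | flagRank p ≤ flagRank q} =
      ⋂ i, ⋂ j, {p | flagRank p i j ≤ flagRank q i j} := by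
    ext p
    simp [Pi.le_def]
  rw [this]
  let _ := zariskiFlagPair k n r
  exact isOpen_iInter_of_finite fun i => isOpen_iInter_of_finite fun j => isOpen_flagRank_le i j _

end RelativePosition

/-! ### Curves of flags and irreducibility -/

section Curves

open Polynomial Filter

variable {k : Type*} [Field k] {n r : ℕ}

open Classical in
/-- The action of a matrix on flags, extended by the identity to singular matrices. -/
noncomputable def matrixAct (M : Matrix (Fin r) (Fin r) k) (q : StepFlag k n r) :
    StepFlag k n r :=
  if h : IsUnit M then (h.unit : Matrix.GeneralLinearGroup (Fin r) k) • q else q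

theorem matrixAct_coe (g : Matrix.GeneralLinearGroup (Fin r) k) (q : StepFlag k n r) :
    matrixAct (g : Matrix (Fin r) (Fin r) k) q = g • q := by
  rw [matrixAct, dif_pos g.isUnit]
  congr 1
  exact Units.ext rfl

/-- A family of flags obtained by applying a matrix of polynomials to a fixed flag. -/
structure FlagCurve (k : Type*) [Field k] (n r : ℕ) where
  base : StepFlag k n r
  mat : Matrix (Fin r) (Fin r) k[X]

namespace FlagCurve

/-- The matrix of the family at the parameter `t`. -/
noncomputable def matAt (γ : FlagCurve k n r) (t : k) : Matrix (Fin r) (Fin r) k :=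
  (evalRingHom t).mapMatrix γ.mat

/-- The flag of the family at the parameter `t`. -/
noncomputable def flagAt (γ : FlagCurve k n r) (t : k) : StepFlag k n r :=
  matrixAct (γ.matAt t) γ.base

theorem eventually_eval_ne_zero {Q : k[X]} {t₀ : k} (h : Q.eval t₀ ≠ 0) :
    ∀ᶠ t in cofinite, Q.eval t ≠ 0 := by
  have hQ : Q ≠ 0 := by
    rintro rfl
    simp at h
  have := Polynomial.finite_setOfPred_isRoot hQ
  rw [eventually_cofinite]
  simpa [IsRoot] using this

theorem isUnit_matAt_iff (γ : FlagCurve k n r) (t : k) :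
    IsUnit (γ.matAt t) ↔ γ.mat.det.eval t ≠ 0 := by
  rw [Matrix.isUnit_iff_isUnit_det, matAt, ← RingHom.map_det, isUnit_iff_ne_zero,
    coe_evalRingHom]

theorem eventually_isUnit {γ : FlagCurve k n r} {t₀ : k} (h : IsUnit (γ.matAt t₀)) :
    ∀ᶠ t in cofinite, IsUnit (γ.matAt t) := by
  simp only [isUnit_matAt_iff] at h ⊢
  exact eventually_eval_ne_zero h

/-- Pulled back along the two polynomial matrices, a basic open neighbourhood becomes the
nonvanishing set of a one-variable polynomial `Q` with `Q t₀ ≠ 0`, and `Q` has finitely many roots.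
The finitely many singular parameters are discarded as well. -/
theorem eventually_mem {γ γ' : FlagCurve k n r} {t₀ : k} (h : IsUnit (γ.matAt t₀))
    (h' : IsUnit (γ'.matAt t₀)) {U : Set (StepFlag k n r × StepFlag k n r)}
    (hU : @IsOpen _ (zariskiFlagPair k n r) U) (hmem : (γ.flagAt t₀, γ'.flagAt t₀) ∈ U) :
    ∀ᶠ t in cofinite, (γ.flagAt t, γ'.flagAt t) ∈ U := by
  have h1 := isOpen_iSup_iff.1 hU (γ.base, γ'.base)
  rw [isOpen_coinduced, @isOpen_induced_iff _ _ (zariskiAffine _ k)] at h1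
  obtain ⟨V, hV, hVU⟩ := h1
  have key : ∀ t, IsUnit (γ.matAt t) → IsUnit (γ'.matAt t) →
      ((γ.flagAt t, γ'.flagAt t) ∈ U ↔
        (Sum.elim (fun ij => γ.matAt t ij.1 ij.2) (fun ij => γ'.matAt t ij.1 ij.2) :
          (Fin r × Fin r) ⊕ (Fin r × Fin r) → k) ∈ V) := by
    rintro t ⟨g, hg⟩ ⟨g', hg'⟩
    have := Set.ext_iff.1 hVU (g, g')
    rw [flagAt, flagAt, ← hg, ← hg', matrixAct_coe, matrixAct_coe]
    exact this.symm
  rw [key t₀ h h'] at hmem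
  obtain ⟨P, hP, hPV⟩ := zariskiAffine_exists_polynomial hV hmem
  let Q : k[X] := MvPolynomial.aeval
    (Sum.elim (fun ij => γ.mat ij.1 ij.2) (fun ij => γ'.mat ij.1 ij.2)) P
  have hQ : ∀ t, Q.eval t = MvPolynomial.eval
      (Sum.elim (fun ij => γ.matAt t ij.1 ij.2) (fun ij => γ'.matAt t ij.1 ij.2)) P := by
    intro t
    simp only [Q]
    rw [← coe_evalRingHom, MvPolynomial.aeval_def, MvPolynomial.hom_eval₂,
      ← MvPolynomial.eval₂_id]
    congr 1
    · ext a
      simp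
    · ext ij
      rcases ij with ij | ij <;> rfl
  filter_upwards [eventually_isUnit h, eventually_isUnit h',
    eventually_eval_ne_zero (Q := Q) (t₀ := t₀) (by rwa [hQ])] with t h1 h2 h3
  rw [key t h1 h2]
  exact hPV _ (by rwa [← hQ])

/-- The line from the identity to `b`. -/
noncomputable def line (b : Matrix (Fin r) (Fin r) k) : Matrix (Fin r) (Fin r) k[X] :=
  (1 - X : k[X]) • 1 + (X : k[X]) • b.map C

theorem mapMatrix_line (b : Matrix (Fin r) (Fin r) k) (t : k) :
    (evalRingHom t).mapMatrix (line b) = (1 - t) • 1 + t • b := by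
  ext i j
  simp [line, Matrix.one_apply, apply_ite]
  ring

/-- The line from `1` to `g` may meet singular matrices. Only the values at `0` and `1` matter here;
later statements about other parameters hold only up to finitely many exceptions. -/
theorem exists_through {p p' : StepFlag k n r} {g : Matrix.GeneralLinearGroup (Fin r) k}
    (h : p' = g • p) : ∃ γ : FlagCurve k n r, IsUnit (γ.matAt 0) ∧ IsUnit (γ.matAt 1) ∧
      γ.flagAt 0 = p ∧ γ.flagAt 1 = p' := by
  refine ⟨⟨p, line g⟩, ?_⟩
  have h0 : (⟨p, line g⟩ : FlagCurve k n r).matAt 0 =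
      ((1 : Matrix.GeneralLinearGroup (Fin r) k) : Matrix (Fin r) (Fin r) k) := by
    simp only [matAt, mapMatrix_line]
    simp
  have h1 : (⟨p, line g⟩ : FlagCurve k n r).matAt 1 = (g : Matrix (Fin r) (Fin r) k) := by
    simp only [matAt, mapMatrix_line]
    simp
  refine ⟨by rw [h0]; exact Units.isUnit _, by rw [h1]; exact Units.isUnit _, ?_, ?_⟩
  · rw [flagAt, h0, matrixAct_coe, one_smul]
  · rw [flagAt, h1, matrixAct_coe, h]

/-- The matrices mapping each step of `q` into itself form a linear subspace containing `1` and `b`,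
hence the whole line; an invertible one preserves the steps by dimension. -/
theorem smul_eq_of_line {b c : Matrix.GeneralLinearGroup (Fin r) k} {q : StepFlag k n r}
    (hb : b • q = q) {t : k}
    (hc : (c : Matrix (Fin r) (Fin r) k) = (1 - t) • 1 + t • (b : Matrix (Fin r) (Fin r) k)) :
    c • q = q := by
  apply StepFlag.ext
  funext i
  apply Submodule.eq_of_le_of_finrank_eq
  · rw [StepFlag.smul_space, hc]
    rintro _ ⟨x, hx, rfl⟩
    have hbx : Matrix.toLin' (b : Matrix (Fin r) (Fin r) k) x ∈ q.space i := by
      rw [← hb, StepFlag.smul_space]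
      exact ⟨x, hx, rfl⟩
    have : Matrix.toLin' ((1 - t) • 1 + t • (b : Matrix (Fin r) (Fin r) k)) x =
        (1 - t) • x + t • Matrix.toLin' (b : Matrix (Fin r) (Fin r) k) x := by
      simp
    rw [this]
    exact add_mem (Submodule.smul_mem _ _ hx) (Submodule.smul_mem _ _ hbx)
  · exact StepFlag.finrank_smul_space c q i

/-- A curve of flags can be extended to a curve of pairs of flags in a given orbit, with
prescribed pairs at `0` and `1`. -/
theorem exists_extension {γ : FlagCurve k n r} (h0 : IsUnit (γ.matAt 0))
    (h1 : IsUnit (γ.matAt 1)) {A : FlagPairOrbit k n r} {p p' : StepFlag k n r}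
    (hp : (γ.flagAt 0, p) ∈ A.orbit) (hp' : (γ.flagAt 1, p') ∈ A.orbit) :
    ∃ γ' : FlagCurve k n r, IsUnit (γ'.matAt 0) ∧ IsUnit (γ'.matAt 1) ∧
      γ'.flagAt 0 = p ∧ γ'.flagAt 1 = p' ∧
      ∀ᶠ t in cofinite, (γ.flagAt t, γ'.flagAt t) ∈ A.orbit := by
  obtain ⟨x, hx⟩ := exists_smul_of_mem_orbit hp hp'
  obtain ⟨g0, hg0⟩ := h0
  obtain ⟨g1, hg1⟩ := h1
  have e0 : γ.flagAt 0 = g0 • γ.base := by rw [flagAt, ← hg0, matrixAct_coe]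
  have e1 : γ.flagAt 1 = g1 • γ.base := by rw [flagAt, ← hg1, matrixAct_coe]
  have hx1 : g1 • γ.base = x • g0 • γ.base := by
    rw [← e0, ← e1]
    exact congrArg Prod.fst hx
  have hx2 : p' = x • p := congrArg Prod.snd hx
  -- Chosen so that `g1 * b * g0⁻¹ = x`, which carries `p` to `p'`. Since `b` fixes `γ.base`, so
  -- does its line where invertible: the factor `line b` steers the second flag without disturbing
  -- the first.
  let b := g1⁻¹ * x * g0
  have hb : b • γ.base = γ.base := by
    simp only [b, mul_smul]
    rw [← hx1, inv_smul_smul]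
  let γ' : FlagCurve k n r := ⟨g0⁻¹ • p, γ.mat * line b⟩
  have hm : ∀ t, γ'.matAt t = γ.matAt t * ((1 - t) • 1 + t • (b : Matrix (Fin r) (Fin r) k)) := by
    intro t
    simp only [γ', matAt, map_mul, mapMatrix_line]
  have m0 : γ'.matAt 0 = g0 := by rw [hm, ← hg0]; simp
  have m1 : γ'.matAt 1 = ((g1 * b : Matrix.GeneralLinearGroup (Fin r) k) :
      Matrix (Fin r) (Fin r) k) := by rw [hm, ← hg1]; simp
  have u0 : IsUnit (γ'.matAt 0) := m0 ▸ Units.isUnit _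
  refine ⟨γ', u0, m1 ▸ Units.isUnit _, ?_, ?_, ?_⟩
  · rw [flagAt, m0, matrixAct_coe]
    exact smul_inv_smul g0 p
  · rw [flagAt, m1, matrixAct_coe, hx2]
    simp only [γ', b, mul_smul, smul_inv_smul]
  · have hbase : (γ.base, g0⁻¹ • p) ∈ A.orbit := by
      have := smul_mem_orbit hp g0⁻¹
      rwa [e0, Prod.smul_mk, inv_smul_smul] at this
    -- At an invertible parameter both factors are invertible, and their product moves the fixed
    -- pair `(γ.base, g0⁻¹ • p)` to the pair of current flags.
    filter_upwards [eventually_isUnit u0] with t ht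
    have ht' := ht
    rw [hm, Matrix.isUnit_iff_isUnit_det, Matrix.det_mul, IsUnit.mul_iff,
      ← Matrix.isUnit_iff_isUnit_det, ← Matrix.isUnit_iff_isUnit_det] at ht'
    obtain ⟨⟨m, hmt⟩, ⟨c, hc⟩⟩ := ht'
    have hmc : γ'.matAt t = ((m * c : Matrix.GeneralLinearGroup (Fin r) k) :
      Matrix (Fin r) (Fin r) k) := by rw [hm, ← hmt, ← hc]; simp
    have := smul_mem_orbit hbase (m * c)
    rw [flagAt, flagAt, ← hmt, hmc, matrixAct_coe, matrixAct_coe]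
    rwa [Prod.smul_mk, mul_smul, smul_eq_of_line hb hc] at this

end FlagCurve

/-- `S(A, A')` is irreducible. -/
theorem orbitProductSet_irreducible [Infinite k] {A A' : FlagPairOrbit k n r}
    {U U' : Set (StepFlag k n r × StepFlag k n r)}
    (hU : @IsOpen _ (zariskiFlagPair k n r) U) (hU' : @IsOpen _ (zariskiFlagPair k n r) U')
    {p p' : StepFlag k n r × StepFlag k n r}
    (hp : p ∈ orbitProductSet A A') (hp' : p' ∈ orbitProductSet A A') (hpU : p ∈ U)
    (hpU' : p' ∈ U') : ∃ q ∈ orbitProductSet A A', q ∈ U ∧ q ∈ U' := by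
  obtain ⟨f, hf1, hf2⟩ := hp
  obtain ⟨f', hf1', hf2'⟩ := hp'
  obtain ⟨x, hx⟩ := exists_smul_of_mem_orbit hf1 hf1'
  obtain ⟨α, α0, α1, a0, a1⟩ := FlagCurve.exists_through (congrArg Prod.fst hx)
  simp only at a0 a1
  obtain ⟨β, β0, β1, b0, b1, hβ⟩ := FlagCurve.exists_extension α0 α1
    (a0.symm ▸ hf1) (a1.symm ▸ hf1')
  obtain ⟨δ, δ0, δ1, d0, d1, hδ⟩ := FlagCurve.exists_extension β0 β1
    (b0.symm ▸ hf2) (b1.symm ▸ hf2')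
  have e0 := FlagCurve.eventually_mem α0 δ0 hU (by rw [a0, d0]; exact hpU)
  have e1 := FlagCurve.eventually_mem α1 δ1 hU' (by rw [a1, d1]; exact hpU')
  -- Each condition fails at finitely many parameters only, so a common parameter exists in the
  -- infinite field.
  obtain ⟨t, ht⟩ := (hβ.and (hδ.and (e0.and e1))).exists
  exact ⟨_, ⟨_, ht.1, ht.2.1⟩, ht.2.2.1, ht.2.2.2⟩

/-- The chains `p₀, p₁, p₂, p₃` of flags whose consecutive pairs lie in three given orbits. -/
def IsOrbitChain (A B C : FlagPairOrbit k n r) (p : Fin 4 → StepFlag k n r) : Prop :=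
  (p 0, p 1) ∈ A.orbit ∧ (p 1, p 2) ∈ B.orbit ∧ (p 2, p 3) ∈ C.orbit

/-- The two open conditions may concern different members of the chain. Associativity needs this: it
imposes minimality on an inner pair and on the end pair at once. -/
theorem isOrbitChain_irreducible [Infinite k] {A B C : FlagPairOrbit k n r}
    {U U' : Set (StepFlag k n r × StepFlag k n r)}
    (hU : @IsOpen _ (zariskiFlagPair k n r) U) (hU' : @IsOpen _ (zariskiFlagPair k n r) U')
    {p p' : Fin 4 → StepFlag k n r} (hp : IsOrbitChain A B C p) (hp' : IsOrbitChain A B C p')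
    {i j i' j' : Fin 4} (hpU : (p i, p j) ∈ U) (hpU' : (p' i', p' j') ∈ U') :
    ∃ q, IsOrbitChain A B C q ∧ (q i, q j) ∈ U ∧ (q i', q j') ∈ U' := by
  obtain ⟨h1, h2, h3⟩ := hp
  obtain ⟨h1', h2', h3'⟩ := hp'
  obtain ⟨x, hx⟩ := exists_smul_of_mem_orbit h1 h1'
  obtain ⟨α, α0, α1, a0, a1⟩ := FlagCurve.exists_through (congrArg Prod.fst hx)
  simp only at a0 a1
  obtain ⟨β, β0, β1, b0, b1, hβ⟩ := FlagCurve.exists_extension α0 α1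
    (a0.symm ▸ h1) (a1.symm ▸ h1')
  obtain ⟨δ, δ0, δ1, d0, d1, hδ⟩ := FlagCurve.exists_extension β0 β1
    (b0.symm ▸ h2) (b1.symm ▸ h2')
  obtain ⟨ε, ε0, ε1, c0, c1, hε⟩ := FlagCurve.exists_extension δ0 δ1
    (d0.symm ▸ h3) (d1.symm ▸ h3')
  let ζ : Fin 4 → FlagCurve k n r := ![α, β, δ, ε]
  have z0 : ∀ i, IsUnit ((ζ i).matAt 0) ∧ (ζ i).flagAt 0 = p i := by
    intro i
    fin_cases i
    exacts [⟨α0, a0⟩, ⟨β0, b0⟩, ⟨δ0, d0⟩, ⟨ε0, c0⟩]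
  have z1 : ∀ i, IsUnit ((ζ i).matAt 1) ∧ (ζ i).flagAt 1 = p' i := by
    intro i
    fin_cases i
    exacts [⟨α1, a1⟩, ⟨β1, b1⟩, ⟨δ1, d1⟩, ⟨ε1, c1⟩]
  have e0 := FlagCurve.eventually_mem (z0 i).1 (z0 j).1 hU
    (by rw [(z0 i).2, (z0 j).2]; exact hpU)
  have e1 := FlagCurve.eventually_mem (z1 i').1 (z1 j').1 hU'
    (by rw [(z1 i').2, (z1 j').2]; exact hpU')
  obtain ⟨t, ht⟩ := (hβ.and (hδ.and (hε.and (e0.and e1)))).exists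
  exact ⟨fun i => (ζ i).flagAt t, ⟨ht.1, ht.2.1, ht.2.2.1⟩, ht.2.2.2.1, ht.2.2.2.2⟩

end Curves

/-! ### Complete flags and the Bruhat decomposition -/

section CompleteFlags

variable {k : Type*} [Field k] {n : ℕ}

/-- A complete flag: the `i`-th step has dimension `i`. -/
def StepFlag.IsComplete (f : StepFlag k n n) : Prop :=
  ∀ i, Module.finrank k (f.space i) = (i : ℕ)

theorem StepFlag.isComplete_smul_iff (g : Matrix.GeneralLinearGroup (Fin n) k)
    (f : StepFlag k n n) : (g • f).IsComplete ↔ f.IsComplete := by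
  simp only [StepFlag.IsComplete, StepFlag.finrank_smul_space]

theorem mem_coordFlag_space {r : ℕ} (c : Fin r → Fin n) (i : Fin (n + 1)) (v : Fin r → k) :
    v ∈ (coordFlag c : StepFlag k n r).space i ↔ ∀ l, v l ≠ 0 → (c l : ℕ) < i := by
  have h : {v : Fin r → k | ∃ l, (c l : ℕ) < (i : ℕ) ∧ v = Pi.single l 1} =
      Pi.basisFun k (Fin r) '' {l | (c l : ℕ) < i} := by
    ext v
    simp [eq_comm]
  change v ∈ Submodule.span k _ ↔ _
  rw [h, Module.Basis.mem_span_image]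
  simp [Set.subset_def]

/-- An intersection of coordinate subspaces is spanned by the basis vectors they share. -/
theorem flagRank_coordFlag (σ τ : Equiv.Perm (Fin n)) (i j : Fin (n + 1)) :
    flagRank ((coordFlag σ, coordFlag τ) : StepFlag k n n × StepFlag k n n) i j =
      (Finset.univ.filter fun l : Fin n => (σ l : ℕ) < i ∧ (τ l : ℕ) < j).card := by
  have h : (coordFlag σ : StepFlag k n n).space i ⊓ (coordFlag τ : StepFlag k n n).space j =
      Submodule.span k (Set.range fun l : {l : Fin n // (σ l : ℕ) < i ∧ (τ l : ℕ) < j} =>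
        Pi.basisFun k (Fin n) l) := by
    have : (Set.range fun l : {l : Fin n // (σ l : ℕ) < i ∧ (τ l : ℕ) < j} =>
        Pi.basisFun k (Fin n) l) =
        Pi.basisFun k (Fin n) '' {l | (σ l : ℕ) < i ∧ (τ l : ℕ) < j} := by
      ext v
      simp [and_assoc]
    rw [this]
    ext v
    rw [Submodule.mem_inf, mem_coordFlag_space, mem_coordFlag_space, Module.Basis.mem_span_image]
    simp only [Set.subset_def, Finset.mem_coe, Finsupp.mem_support_iff, Pi.basisFun_repr,
      Set.mem_ofPred_eq]
    exact ⟨fun h l hl => ⟨h.1 l hl, h.2 l hl⟩, fun h => ⟨fun l hl => (h l hl).1,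
      fun l hl => (h l hl).2⟩⟩
  change Module.finrank k ↥((coordFlag σ : StepFlag k n n).space i ⊓
    (coordFlag τ : StepFlag k n n).space j) = _
  rw [h]
  rw [finrank_span_eq_card, Fintype.card_subtype]
  exact (Pi.basisFun k (Fin n)).linearIndependent.comp _ Subtype.val_injective

theorem card_filter_perm_lt (σ : Equiv.Perm (Fin n)) (i : Fin (n + 1)) :
    (Finset.univ.filter fun l : Fin n => (σ l : ℕ) < i).card = i := by
  rw [← Finset.card_map σ.toEmbedding]
  have : (Finset.univ.filter fun l : Fin n => (σ l : ℕ) < i).map σ.toEmbedding =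
      Finset.univ.filter fun l : Fin n => (l : ℕ) < i := by
    ext l
    simp only [Finset.mem_map, Finset.mem_filter, Finset.mem_univ, true_and,
      Equiv.coe_toEmbedding]
    exact ⟨fun ⟨a, ha, hal⟩ => hal ▸ ha, fun h => ⟨σ.symm l, by simpa using h, by simp⟩⟩
  rw [this, Fin.card_filter_val_lt]
  exact min_eq_right (Nat.lt_succ_iff.1 i.2)

theorem isComplete_coordFlag (σ : Equiv.Perm (Fin n)) :
    (coordFlag σ : StepFlag k n n).IsComplete := by
  intro i
  have h := flagRank_coordFlag (k := k) σ 1 i (Fin.last n)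
  unfold flagRank at h
  rw [StepFlag.last', inf_top_eq] at h
  rw [h]
  simp [card_filter_perm_lt]

theorem isComplete_coordFlag_id : (coordFlag id : StepFlag k n n).IsComplete :=
  isComplete_coordFlag 1

/-- The relative position of coordinate flags determines the permutation. -/
theorem perm_eq_of_flagRank_eq {σ τ : Equiv.Perm (Fin n)}
    (h : flagRank ((coordFlag σ, coordFlag id) : StepFlag k n n × StepFlag k n n) =
      flagRank ((coordFlag τ, coordFlag id) : StepFlag k n n × StepFlag k n n)) : σ = τ := by
  -- Enlarging the second step by `e_b` raises the intersection dimension exactly when `e_b` lies in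
  -- the first one, so the jumps recover `ρ`.
  have key : ∀ (ρ : Equiv.Perm (Fin n)) (a : Fin (n + 1)) (b : Fin n), (ρ b : ℕ) < a ↔
      flagRank ((coordFlag ρ, coordFlag id) : StepFlag k n n × StepFlag k n n) a b.castSucc <
        flagRank ((coordFlag ρ, coordFlag id) : StepFlag k n n × StepFlag k n n) a b.succ := by
    intro ρ a b
    have h1 := flagRank_coordFlag (k := k) ρ 1
    rw [Equiv.Perm.coe_one] at h1
    rw [h1, h1]
    simp only [id, Fin.val_castSucc, Fin.val_succ]
    constructor
    · intro hb
      apply Finset.card_lt_card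
      rw [Finset.ssubset_iff_of_subset]
      · exact ⟨b, by simpa using hb, by simp⟩
      · intro l
        simp only [Finset.mem_filter, Finset.mem_univ, true_and]
        exact fun hl => ⟨hl.1, by omega⟩
    · intro hlt
      by_contra hb
      apply hlt.not_ge
      apply Finset.card_le_card
      intro l
      simp only [Finset.mem_filter, Finset.mem_univ, true_and]
      rintro ⟨hl1, hl2⟩
      refine ⟨hl1, ?_⟩
      have : l ≠ b := by
        rintro rfl
        exact hb hl1
      have : (l : ℕ) ≠ b := fun h => this (Fin.ext h)
      omega
  ext b
  have h1 : ∀ a : Fin (n + 1), (σ b : ℕ) < a ↔ (τ b : ℕ) < a := fun a => by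
    rw [key σ, key τ, h]
  have h2 := h1 (σ b).succ
  have h3 := h1 (τ b).succ
  simp only [Fin.val_succ] at h2 h3
  omega

/-- The columns of an invertible matrix, from a spanning family. -/
theorem exists_GL_single {v : Fin n → Fin n → k} (hv : LinearIndependent k v) :
    ∃ g : Matrix.GeneralLinearGroup (Fin n) k,
      ∀ l, Matrix.toLin' (g : Matrix (Fin n) (Fin n) k) (Pi.single l 1) = v l := by
  have hu : IsUnit (Matrix.of v).transpose := by
    rw [← Matrix.linearIndependent_cols_iff_isUnit]
    exact hv
  refine ⟨hu.unit, fun l => ?_⟩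
  rw [Matrix.toLin'_apply, IsUnit.unit_spec, Matrix.mulVec_single_one]
  rfl

theorem smul_coordFlag_eq {g : Matrix.GeneralLinearGroup (Fin n) k} {f : StepFlag k n n}
    (hf : f.IsComplete) (σ : Equiv.Perm (Fin n))
    (h : ∀ l (i : Fin (n + 1)), (σ l : ℕ) < i →
      Matrix.toLin' (g : Matrix (Fin n) (Fin n) k) (Pi.single l 1) ∈ f.space i) :
    g • coordFlag σ = f := by
  apply StepFlag.ext
  funext i
  apply Submodule.eq_of_le_of_finrank_eq
  · rw [StepFlag.smul_space, Submodule.map_le_iff_le_comap]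
    apply Submodule.span_le.2
    rintro _ ⟨l, hl, rfl⟩
    exact h l i hl
  · rw [StepFlag.finrank_smul_space, isComplete_coordFlag, hf]

/-- In a complete flag each step is generated by the previous one and any vector outside it. -/
theorem StepFlag.IsComplete.exists_sub_smul_mem {f : StepFlag k n n} (hf : f.IsComplete)
    {a : Fin n} {v w : Fin n → k} (hv : v ∈ f.space a.succ) (hv' : v ∉ f.space a.castSucc)
    (hw : w ∈ f.space a.succ) : ∃ c : k, w - c • v ∈ f.space a.castSucc := by
  have h : f.space a.succ = f.space a.castSucc ⊔ Submodule.span k {v} := by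
    symm
    have hle : f.space a.castSucc ⊔ Submodule.span k {v} ≤ f.space a.succ :=
      sup_le (f.mono' (Fin.castSucc_lt_succ).le) (by simpa using hv)
    apply Submodule.eq_of_le_of_finrank_le hle
    have hlt : f.space a.castSucc < f.space a.castSucc ⊔ Submodule.span k {v} := by
      refine lt_of_le_of_ne le_sup_left fun h => hv' ?_
      rw [h]
      exact Submodule.mem_sup_right (Submodule.mem_span_singleton_self v)
    have := Submodule.finrank_lt_finrank_of_lt hlt
    rw [hf] at this ⊢
    simpa using this
  rw [h] at hw
  obtain ⟨x, hx, y, hy, rfl⟩ := Submodule.mem_sup.1 hw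
  obtain ⟨c, rfl⟩ := Submodule.mem_span_singleton.1 hy
  exact ⟨c, by simpa using hx⟩

/-- Vectors `v_j` in the successive differences of the steps of a complete flag are linearly
independent. -/
theorem StepFlag.IsComplete.linearIndependent {f : StepFlag k n n} (hf : f.IsComplete)
    {v : Fin n → Fin n → k} (hv : ∀ j, v j ∈ f.space j.succ)
    (hv' : ∀ j, v j ∉ f.space j.castSucc) : LinearIndependent k v := by
  apply linearIndependent_of_top_le_span_of_card_eq_finrank
  · rw [← f.last']
    have : ∀ i : Fin (n + 1), f.space i ≤ Submodule.span k (Set.range v) := by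
      intro i
      induction i using Fin.induction with
      | zero => rw [f.zero']; exact bot_le
      | succ j ih =>
        intro w hw
        obtain ⟨c, hc⟩ := hf.exists_sub_smul_mem (hv j) (hv' j) hw
        have := add_mem (ih hc) (Submodule.smul_mem _ c
          (Submodule.subset_span (Set.mem_range_self (f := v) j)))
        simpa using this
    exact this _
  · simp

/-- Bruhat decomposition: any two complete flags have a common adapted basis. -/
theorem exists_eq_smul_coordFlag {f f' : StepFlag k n n} (hf : f.IsComplete)
    (hf' : f'.IsComplete) : ∃ (σ : Equiv.Perm (Fin n)) (g : Matrix.GeneralLinearGroup (Fin n) k),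
      f = g • coordFlag σ ∧ f' = g • coordFlag id := by
  classical
  -- For each `j`, the least step of `f` containing a vector `v` of `f'` that is new at step `j + 1`
  -- is sought. Its index gives `σ j`, and these vectors form the common adapted basis.
  have hex : ∀ j : Fin n, ∃ a : ℕ, ∃ i : Fin (n + 1), (i : ℕ) = a ∧
      ∃ v, v ∈ f.space i ∧ v ∈ f'.space j.succ ∧ v ∉ f'.space j.castSucc := by
    intro j
    refine ⟨n, Fin.last n, rfl, ?_⟩
    rw [f.last']
    have hlt : f'.space j.castSucc < f'.space j.succ := by
      refine lt_of_le_of_ne (f'.mono' Fin.castSucc_lt_succ.le) fun h => ?_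
      have := hf' j.succ
      rw [← h, hf'] at this
      simp at this
    obtain ⟨v, hv, hv'⟩ := SetLike.exists_of_lt hlt
    exact ⟨v, trivial, hv, hv'⟩
  have hmin : ∀ j : Fin n, ∃ (a : Fin n) (v : Fin n → k), v ∈ f.space a.succ ∧
      v ∈ f'.space j.succ ∧ v ∉ f'.space j.castSucc ∧
      ∀ w ∈ f.space a.castSucc, w ∈ f'.space j.succ → w ∈ f'.space j.castSucc := by
    intro j
    obtain ⟨i, hi, v, hv, hvj, hvj'⟩ := Nat.find_spec (hex j)
    induction i using Fin.cases with
    | zero =>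
      rw [f.zero', Submodule.mem_bot] at hv
      rw [hv] at hvj'
      exact absurd (zero_mem _) hvj'
    | succ a =>
      refine ⟨a, v, hv, hvj, hvj', fun w hw hwj => ?_⟩
      by_contra hwj'
      refine Nat.find_min (hex j) (m := a) ?_ ⟨a.castSucc, rfl, w, hw, hwj, hwj'⟩
      rw [← hi]
      simp
  choose σ v hσ hv hv' hm using hmin
  -- If `σ j = σ j'`, some `v j' - c • v j` falls into the preceding step of `f`. Minimality then
  -- puts it in `f'.space j'.castSucc`, which already contains `v j`, hence also `v j'`: a
  -- contradiction.
  have hinj : ∀ j j', j < j' → σ j ≠ σ j' := by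
    intro j j' hlt heq
    have hσj : v j ∉ f.space (σ j).castSucc := fun h => hv' j (hm j _ h (hv j))
    obtain ⟨c, hc⟩ := hf.exists_sub_smul_mem (hσ j) hσj (heq ▸ hσ j')
    have hj : v j ∈ f'.space j'.castSucc := f'.mono' (Fin.succ_le_castSucc_iff.2 hlt) (hv j)
    have hmem := hm j' _ (heq ▸ hc) (sub_mem (hv j') (Submodule.smul_mem _ c
      (f'.mono' Fin.castSucc_lt_succ.le hj)))
    apply hv' j'
    simpa using add_mem hmem (Submodule.smul_mem _ c hj)
  have hσinj : Function.Injective σ := by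
    intro j j' h
    by_contra hne
    rcases lt_or_gt_of_ne hne with hlt | hlt
    · exact hinj _ _ hlt h
    · exact hinj _ _ hlt h.symm
  obtain ⟨g, hg⟩ := exists_GL_single (hf'.linearIndependent hv hv')
  refine ⟨Equiv.ofBijective σ (Finite.injective_iff_bijective.1 hσinj), g,
    (smul_coordFlag_eq hf _ fun l i hl => ?_).symm,
    (smul_coordFlag_eq hf' 1 fun l i hl => ?_).symm⟩
  · rw [hg]
    exact f.mono' (Fin.le_def.2 (by rw [Fin.val_succ]; exact hl)) (hσ l)
  · rw [hg]
    exact f'.mono' (Fin.le_def.2 (by rw [Fin.val_succ]; exact hl)) (hv l)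

theorem exists_flagPairOrbit_eq {f f' : StepFlag k n n} (hf : f.IsComplete)
    (hf' : f'.IsComplete) : ∃ σ : Equiv.Perm (Fin n),
      flagPairOrbit f f' = flagPairOrbit (coordFlag σ) (coordFlag id) := by
  obtain ⟨σ, g, rfl, rfl⟩ := exists_eq_smul_coordFlag hf hf'
  exact ⟨σ, mem_orbit_iff_flagPairOrbit_eq.1 (mem_orbit_flagPairOrbit.2 ⟨g, rfl⟩)⟩

theorem StepFlag.IsComplete.exists_smul_eq {f f' : StepFlag k n n} (hf : f.IsComplete)
    (hf' : f'.IsComplete) : ∃ g : Matrix.GeneralLinearGroup (Fin n) k, f' = g • f := by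
  -- Bruhat is applied to a flag paired with itself only to exhibit it as a translate of the
  -- standard flag.
  obtain ⟨_, g, _, h⟩ := exists_eq_smul_coordFlag hf hf
  obtain ⟨_, g', _, h'⟩ := exists_eq_smul_coordFlag hf' hf'
  exact ⟨g' * g⁻¹, by rw [h, h', mul_smul, inv_smul_smul]⟩

/-- The orbit of a pair of complete flags is determined by the relative position. -/
theorem flagPairOrbit_eq_of_flagRank_eq {f f' q q' : StepFlag k n n} (hf : f.IsComplete)
    (hf' : f'.IsComplete) (hq : q.IsComplete) (hq' : q'.IsComplete)
    (h : flagRank (f, f') = flagRank (q, q')) : flagPairOrbit f f' = flagPairOrbit q q' := by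
  obtain ⟨σ, hσ⟩ := exists_flagPairOrbit_eq hf hf'
  obtain ⟨τ, hτ⟩ := exists_flagPairOrbit_eq hq hq'
  have h1 := flagRank_eq_of_mem_orbit (mem_orbit_iff_flagPairOrbit_eq.2 hσ)
    (mem_orbit_iff_flagPairOrbit_eq.2 rfl)
  have h2 := flagRank_eq_of_mem_orbit (mem_orbit_iff_flagPairOrbit_eq.2 hτ)
    (mem_orbit_iff_flagPairOrbit_eq.2 rfl)
  rw [hσ, hτ, perm_eq_of_flagRank_eq (h1.symm.trans (h.trans h2))]

theorem permOrbit_injective :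
    Function.Injective (permOrbit k : Equiv.Perm (Fin n) → GenericAlgebra k n n) := by
  intro σ τ h
  have h1 : flagPairOrbit (coordFlag σ) (coordFlag id) =
      (flagPairOrbit (coordFlag τ) (coordFlag id) : FlagPairOrbit k n n) :=
    Finsupp.single_left_injective (one_ne_zero' ℤ) h
  exact perm_eq_of_flagRank_eq (flagRank_eq_of_mem_orbit (mem_orbit_iff_flagPairOrbit_eq.2 h1)
    (mem_orbit_iff_flagPairOrbit_eq.2 rfl))

end CompleteFlags

/-! ### Uniqueness and existence of open orbits -/

section OpenOrbits

variable {k : Type*} [Field k] {n r : ℕ}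

theorem flagPairOrbit_nonempty (A : FlagPairOrbit k n r) :
    (MulAction.orbitRel.Quotient.orbit A).Nonempty := by
  induction A using Quotient.inductionOn' with
  | h p => exact ⟨p, MulAction.orbitRel.Quotient.mem_orbit.2 rfl⟩

/-- Nonempty open subsets of an irreducible set meet, and orbits that meet coincide. -/
theorem isOpenOrbitIn_unique [Infinite k] {A A' C D : FlagPairOrbit k n r}
    (hC : IsOpenOrbitIn C (orbitProductSet A A')) (hD : IsOpenOrbitIn D (orbitProductSet A A')) :
    C = D := by
  obtain ⟨U, hU, hUC⟩ := hC
  obtain ⟨U', hU', hUD⟩ := hD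
  obtain ⟨p, hp⟩ := (flagPairOrbit_nonempty C)
  obtain ⟨q, hq⟩ := (flagPairOrbit_nonempty D)
  have hp' := hp
  have hq' := hq
  rw [← hUC] at hp'
  rw [← hUD] at hq'
  obtain ⟨x, hx, hxU, hxU'⟩ := orbitProductSet_irreducible hU hU' hp'.2 hq'.2 hp'.1 hq'.1
  have h1 : x ∈ C.orbit := hUC ▸ ⟨hxU, hx⟩
  have h2 : x ∈ D.orbit := hUD ▸ ⟨hxU', hx⟩
  rw [MulAction.orbitRel.Quotient.mem_orbit] at h1 h2
  exact h1.symm.trans h2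

theorem smul_mem_orbitProductSet {A A' : FlagPairOrbit k n r}
    {p : StepFlag k n r × StepFlag k n r} (hp : p ∈ orbitProductSet A A')
    (g : Matrix.GeneralLinearGroup (Fin r) k) : g • p ∈ orbitProductSet A A' := by
  obtain ⟨f, h1, h2⟩ := hp
  exact ⟨g • f, smul_mem_orbit h1 g, smul_mem_orbit h2 g⟩

theorem orbit_subset_orbitProductSet {A A' C : FlagPairOrbit k n r}
    {p : StepFlag k n r × StepFlag k n r} (hp : p ∈ orbitProductSet A A') (hpC : p ∈ C.orbit) :
    C.orbit ⊆ orbitProductSet A A' := by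
  intro q hq
  obtain ⟨g, rfl⟩ := exists_smul_of_mem_orbit hpC hq
  exact smul_mem_orbitProductSet hp g

theorem orbitStar_eq_zero {A A' : FlagPairOrbit k n r} (h : orbitProductSet A A' = ∅) :
    orbitStar A A' = 0 := by
  rw [orbitStar, dif_neg]
  rintro ⟨C, U, _, hC⟩
  rw [h, Set.inter_empty] at hC
  exact (flagPairOrbit_nonempty C).ne_empty hC.symm

theorem orbitStar_eq_of_orbitProductSet_eq {A A' B : FlagPairOrbit k n r}
    (h : orbitProductSet A A' = B.orbit) : orbitStar A A' = orbitElt B := by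
  have hex : ∃ C, IsOpenOrbitIn C (orbitProductSet A A') :=
    ⟨B, Set.univ, @isOpen_univ _ (zariskiFlagPair k n r), by rw [Set.univ_inter, h]⟩
  rw [orbitStar, dif_pos hex]
  congr 1
  obtain ⟨U, _, hC⟩ := hex.choose_spec
  obtain ⟨p, hp⟩ := (flagPairOrbit_nonempty hex.choose)
  have hp' := hp
  rw [← hC, h] at hp'
  rw [MulAction.orbitRel.Quotient.mem_orbit] at hp
  rw [← hp, ← MulAction.orbitRel.Quotient.mem_orbit]
  exact hp'.2

/-- A minimal value, which exists by well-foundedness, is least once any two values have a common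
lower bound. For `flagRank`, irreducibility supplies that bound. -/
theorem exists_forall_le_of_codirected {α β : Type*} [PartialOrder β] [WellFoundedLT β]
    {X : Set α} (hX : X.Nonempty) (ρ : α → β)
    (h : ∀ p ∈ X, ∀ q ∈ X, ∃ x ∈ X, ρ x ≤ ρ p ∧ ρ x ≤ ρ q) :
    ∃ p ∈ X, ∀ q ∈ X, ρ p ≤ ρ q := by
  obtain ⟨_, ⟨p, hp, rfl⟩, hmin⟩ :=
    (wellFounded_lt (α := β)).has_min (ρ '' X) (hX.image ρ)
  refine ⟨p, hp, fun q hq => ?_⟩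
  obtain ⟨x, hx, hxp, hxq⟩ := h p hp q hq
  have : ρ x = ρ p := eq_of_le_of_not_lt hxp (hmin _ ⟨x, hx, rfl⟩)
  exact this ▸ hxq

end OpenOrbits

/-! ### Products of orbits of complete flags -/

section CompleteOrbits

variable {k : Type*} [Field k] {n : ℕ}

/-- An orbit of pairs of complete flags. -/
def IsCompleteOrbit (A : FlagPairOrbit k n n) : Prop :=
  ∀ p ∈ A.orbit, p.1.IsComplete ∧ p.2.IsComplete

theorem isCompleteOrbit_flagPairOrbit {f f' : StepFlag k n n} (hf : f.IsComplete)
    (hf' : f'.IsComplete) : IsCompleteOrbit (flagPairOrbit f f') := by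
  intro p hp
  obtain ⟨g, rfl⟩ := mem_orbit_flagPairOrbit.1 hp
  exact ⟨(StepFlag.isComplete_smul_iff g f).2 hf, (StepFlag.isComplete_smul_iff g f').2 hf'⟩

theorem isCompleteOrbit_perm (σ : Equiv.Perm (Fin n)) :
    IsCompleteOrbit (flagPairOrbit (coordFlag σ) (coordFlag id) : FlagPairOrbit k n n) :=
  isCompleteOrbit_flagPairOrbit (isComplete_coordFlag σ) isComplete_coordFlag_id

theorem IsCompleteOrbit.exists_perm {A : FlagPairOrbit k n n} (hA : IsCompleteOrbit A) :
    ∃ σ : Equiv.Perm (Fin n), orbitElt A = permOrbit k σ := by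
  obtain ⟨⟨f, f'⟩, hp⟩ := flagPairOrbit_nonempty A
  obtain ⟨hf, hf'⟩ := hA _ hp
  obtain ⟨σ, hσ⟩ := exists_flagPairOrbit_eq hf hf'
  refine ⟨σ, ?_⟩
  rw [permOrbit, ← hσ, mem_orbit_iff_flagPairOrbit_eq.1 hp]

theorem IsCompleteOrbit.exists_right {A : FlagPairOrbit k n n} (hA : IsCompleteOrbit A)
    {f : StepFlag k n n} (hf : f.IsComplete) : ∃ f', (f, f') ∈ A.orbit := by
  obtain ⟨p, hp⟩ := flagPairOrbit_nonempty A
  obtain ⟨g, rfl⟩ := (hA p hp).1.exists_smul_eq hf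
  exact ⟨g • p.2, smul_mem_orbit hp g⟩

theorem IsCompleteOrbit.exists_left {A : FlagPairOrbit k n n} (hA : IsCompleteOrbit A)
    {f : StepFlag k n n} (hf : f.IsComplete) : ∃ f', (f', f) ∈ A.orbit := by
  obtain ⟨p, hp⟩ := flagPairOrbit_nonempty A
  obtain ⟨g, rfl⟩ := (hA p hp).2.exists_smul_eq hf
  exact ⟨g • p.1, smul_mem_orbit hp g⟩

theorem isComplete_of_mem_orbitProductSet {A A' : FlagPairOrbit k n n} (hA : IsCompleteOrbit A)
    (hA' : IsCompleteOrbit A') {p : StepFlag k n n × StepFlag k n n}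
    (hp : p ∈ orbitProductSet A A') : p.1.IsComplete ∧ p.2.IsComplete := by
  obtain ⟨f, h1, h2⟩ := hp
  exact ⟨(hA _ h1).1, (hA' _ h2).2⟩

/-- The product of two orbits is the orbit in minimal relative position. -/
theorem orbitElt_mul_eq_of_minimal [Infinite k] {A A' : FlagPairOrbit k n n}
    (hA : IsCompleteOrbit A) (hA' : IsCompleteOrbit A')
    {p : StepFlag k n n × StepFlag k n n} (hp : p ∈ orbitProductSet A A')
    (hmin : ∀ q ∈ orbitProductSet A A', flagRank p ≤ flagRank q) :
    orbitElt A * orbitElt A' = orbitElt (flagPairOrbit p.1 p.2) := by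
  have hopen : IsOpenOrbitIn (flagPairOrbit p.1 p.2) (orbitProductSet A A') := by
    -- As `p` has the least position in `S`, this open set meets `S` only in pairs of equal
    -- position, which for complete flags form the orbit of `p`.
    refine ⟨_, isOpen_flagRank_le_flagRank p, ?_⟩
    have hpC : p ∈ (flagPairOrbit p.1 p.2).orbit := mem_orbit_iff_flagPairOrbit_eq.2 rfl
    ext q
    constructor
    · rintro ⟨hq, hqS⟩
      apply mem_orbit_iff_flagPairOrbit_eq.2
      obtain ⟨h1, h2⟩ := isComplete_of_mem_orbitProductSet hA hA' hqS
      obtain ⟨h3, h4⟩ := isComplete_of_mem_orbitProductSet hA hA' hp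
      exact flagPairOrbit_eq_of_flagRank_eq h1 h2 h3 h4 (le_antisymm hq (hmin q hqS))
    · intro hq
      exact ⟨(flagRank_eq_of_mem_orbit hq hpC).le, orbit_subset_orbitProductSet hp hpC hq⟩
  have hex : ∃ C, IsOpenOrbitIn C (orbitProductSet A A') := ⟨_, hopen⟩
  rw [orbitElt_mul_orbitElt, orbitStar, dif_pos hex]
  congr 1
  exact isOpenOrbitIn_unique hex.choose_spec hopen

theorem exists_minimal_orbitProductSet [Infinite k] {A A' : FlagPairOrbit k n n}
    (hA : IsCompleteOrbit A) (hA' : IsCompleteOrbit A') :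
    ∃ p ∈ orbitProductSet A A', ∀ q ∈ orbitProductSet A A', flagRank p ≤ flagRank q := by
  apply exists_forall_le_of_codirected
  · obtain ⟨⟨f, f'⟩, hp⟩ := flagPairOrbit_nonempty A
    obtain ⟨f'', h⟩ := hA'.exists_right (hA _ hp).2
    exact ⟨(f, f''), f', hp, h⟩
  · intro p hp q hq
    exact orbitProductSet_irreducible (isOpen_flagRank_le_flagRank p)
      (isOpen_flagRank_le_flagRank q) hp hq (le_refl (flagRank p)) (le_refl (flagRank q))

theorem exists_minimal_isOrbitChain [Infinite k] {A B C : FlagPairOrbit k n n}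
    (hA : IsCompleteOrbit A) (hB : IsCompleteOrbit B) (hC : IsCompleteOrbit C) :
    ∃ p, IsOrbitChain A B C p ∧
      ∀ q, IsOrbitChain A B C q → flagRank (p 0, p 3) ≤ flagRank (q 0, q 3) := by
  apply exists_forall_le_of_codirected (X := {p | IsOrbitChain A B C p})
    (ρ := fun p => flagRank (p 0, p 3))
  · obtain ⟨⟨f, f'⟩, hp⟩ := flagPairOrbit_nonempty A
    obtain ⟨f'', h⟩ := hB.exists_right (hA _ hp).2
    obtain ⟨f''', h'⟩ := hC.exists_right (hB _ h).2
    exact ⟨![f, f', f'', f'''], hp, h, h'⟩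
  · intro p hp q hq
    exact isOrbitChain_irreducible (isOpen_flagRank_le_flagRank (p 0, p 3))
      (isOpen_flagRank_le_flagRank (q 0, q 3)) hp hq (i := 0) (j := 3) (i' := 0) (j' := 3)
      (le_refl (flagRank _)) (le_refl (flagRank _))

/-- Both bracketings equal the orbit of the end pair of a chain whose end pair is in least position
among all chains. -/
theorem orbitElt_mul_assoc [Infinite k] {A B C : FlagPairOrbit k n n}
    (hA : IsCompleteOrbit A) (hB : IsCompleteOrbit B) (hC : IsCompleteOrbit C) :
    orbitElt A * orbitElt B * orbitElt C = orbitElt A * (orbitElt B * orbitElt C) := by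
  obtain ⟨p, hp, hpmin⟩ := exists_minimal_isOrbitChain hA hB hC
  have hcomplete : ∀ x : Fin 4 → StepFlag k n n, IsOrbitChain A B C x → ∀ i, (x i).IsComplete := by
    rintro x ⟨h1, h2, h3⟩ i
    fin_cases i
    exacts [(hA _ h1).1, (hA _ h1).2, (hB _ h2).2, (hC _ h3).2]
  trans orbitElt (flagPairOrbit (p 0) (p 3))
  · obtain ⟨⟨q₀, q₂⟩, hq, hqmin⟩ := exists_minimal_orbitProductSet hA hB
    rw [orbitElt_mul_eq_of_minimal hA hB hq hqmin]
    obtain ⟨q₁, hq₁, hq₂⟩ := hq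
    obtain ⟨q₃, hq₃⟩ := hC.exists_right (hB _ hq₂).2
    -- Irreducibility gives one chain whose inner pair realises the first product and whose end pair
    -- is in least position.
    obtain ⟨x, hx, hx1, hx2⟩ := isOrbitChain_irreducible
      (isOpen_flagRank_le_flagRank (q₀, q₂)) (isOpen_flagRank_le_flagRank (p 0, p 3))
      (p := ![q₀, q₁, q₂, q₃]) ⟨hq₁, hq₂, hq₃⟩ hp (i := 0) (j := 2) (i' := 0) (j' := 3)
      (le_refl (flagRank _)) (le_refl (flagRank _))
    have hxD : (x 0, x 2) ∈ (flagPairOrbit q₀ q₂).orbit := by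
      rw [mem_orbit_iff_flagPairOrbit_eq]
      exact flagPairOrbit_eq_of_flagRank_eq (hcomplete x hx 0) (hcomplete x hx 2)
        (hA _ hq₁).1 (hB _ hq₂).2 (le_antisymm hx1 (hqmin _ ⟨x 1, hx.1, hx.2.1⟩))
    rw [orbitElt_mul_eq_of_minimal
      (isCompleteOrbit_flagPairOrbit (hA _ hq₁).1 (hB _ hq₂).2) hC (p := (x 0, x 3))
      ⟨x 2, hxD, hx.2.2⟩]
    · congr 1
      exact flagPairOrbit_eq_of_flagRank_eq (hcomplete x hx 0) (hcomplete x hx 3)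
        (hcomplete p hp 0) (hcomplete p hp 3) (le_antisymm hx2 (hpmin x hx))
    -- The orbit of the first product lies inside `S(A, B)`, so every competing pair is the end pair
    -- of a full chain and is bounded by `hpmin`.
    · rintro ⟨s, s'⟩ ⟨f, hsf, hfs⟩
      obtain ⟨f', h1, h2⟩ := orbit_subset_orbitProductSet ⟨q₁, hq₁, hq₂⟩
        (mem_orbit_iff_flagPairOrbit_eq.2 rfl) hsf
      exact le_trans hx2 (hpmin ![s, f', f, s'] ⟨h1, h2, hfs⟩)
  · obtain ⟨⟨q₁, q₃⟩, hq, hqmin⟩ := exists_minimal_orbitProductSet hB hC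
    rw [orbitElt_mul_eq_of_minimal hB hC hq hqmin]
    obtain ⟨q₂, hq₂, hq₃⟩ := hq
    obtain ⟨q₀, hq₀⟩ := hA.exists_left (hB _ hq₂).1
    obtain ⟨x, hx, hx1, hx2⟩ := isOrbitChain_irreducible
      (isOpen_flagRank_le_flagRank (q₁, q₃)) (isOpen_flagRank_le_flagRank (p 0, p 3))
      (p := ![q₀, q₁, q₂, q₃]) ⟨hq₀, hq₂, hq₃⟩ hp (i := 1) (j := 3) (i' := 0) (j' := 3)
      (le_refl (flagRank _)) (le_refl (flagRank _))
    have hxD : (x 1, x 3) ∈ (flagPairOrbit q₁ q₃).orbit := by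
      rw [mem_orbit_iff_flagPairOrbit_eq]
      exact flagPairOrbit_eq_of_flagRank_eq (hcomplete x hx 1) (hcomplete x hx 3)
        (hB _ hq₂).1 (hC _ hq₃).2 (le_antisymm hx1 (hqmin _ ⟨x 2, hx.2.1, hx.2.2⟩))
    rw [orbitElt_mul_eq_of_minimal hA
      (isCompleteOrbit_flagPairOrbit (hB _ hq₂).1 (hC _ hq₃).2) (p := (x 0, x 3))
      ⟨x 1, hx.1, hxD⟩]
    · congr 1
      exact flagPairOrbit_eq_of_flagRank_eq (hcomplete p hp 0) (hcomplete p hp 3)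
        (hcomplete x hx 0) (hcomplete x hx 3) (le_antisymm (hpmin x hx) hx2)
    · rintro ⟨s, s'⟩ ⟨f, hsf, hfs⟩
      obtain ⟨f', h1, h2⟩ := orbit_subset_orbitProductSet ⟨q₂, hq₂, hq₃⟩
        (mem_orbit_iff_flagPairOrbit_eq.2 rfl) hfs
      exact le_trans hx2 (hpmin ![s, f, f', s'] ⟨hsf, h1, h2⟩)

theorem permOrbit_mul_assoc [Infinite k] (ρ σ τ : Equiv.Perm (Fin n)) :
    permOrbit k ρ * permOrbit k σ * permOrbit k τ =
      permOrbit k ρ * (permOrbit k σ * permOrbit k τ) :=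
  orbitElt_mul_assoc (isCompleteOrbit_perm ρ) (isCompleteOrbit_perm σ) (isCompleteOrbit_perm τ)

/-- `S` is never empty here, as `GL(V)` is transitive on complete flags; hence the product of two
basis elements is never zero. -/
theorem exists_permOrbit_mul [Infinite k] (σ τ : Equiv.Perm (Fin n)) :
    ∃ ρ, permOrbit k σ * permOrbit k τ = permOrbit k ρ := by
  have hσ := isCompleteOrbit_perm (k := k) σ
  have hτ := isCompleteOrbit_perm (k := k) τ
  obtain ⟨p, hp, hmin⟩ := exists_minimal_orbitProductSet hσ hτ
  obtain ⟨h1, h2⟩ := isComplete_of_mem_orbitProductSet hσ hτ hp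
  obtain ⟨ρ, hρ⟩ := (isCompleteOrbit_flagPairOrbit h1 h2).exists_perm
  exact ⟨ρ, (orbitElt_mul_eq_of_minimal hσ hτ hp hmin).trans hρ⟩

/-! ### The identity `k_d` and the ring `H₀(n)` -/

theorem kOne_eq_permOrbit : kOne k n = permOrbit k 1 := rfl

/-- The orbit `k_d` is the diagonal of the complete flags, so composing with it leaves the other
flag unchanged, or is impossible when the adjoining flag is not complete. -/
theorem mem_orbit_coordFlag_id_iff {p : StepFlag k n n × StepFlag k n n} :
    p ∈ (flagPairOrbit (coordFlag id) (coordFlag id) : FlagPairOrbit k n n).orbit ↔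
      p.1 = p.2 ∧ p.1.IsComplete := by
  constructor
  · intro hp
    refine ⟨?_, (isCompleteOrbit_perm 1 p hp).1⟩
    obtain ⟨g, rfl⟩ := mem_orbit_flagPairOrbit.1 hp
    rfl
  · obtain ⟨f, f'⟩ := p
    rintro ⟨h, hf⟩
    obtain rfl : f = f' := h
    obtain ⟨g, rfl⟩ := isComplete_coordFlag_id.exists_smul_eq hf
    exact mem_orbit_flagPairOrbit.2 ⟨g, rfl⟩

theorem kOne_mul_orbitElt {A : FlagPairOrbit k n n}
    (h : ∀ p ∈ A.orbit, p.1.IsComplete) : kOne k n * orbitElt A = orbitElt A := by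
  rw [kOne, orbitElt_mul_orbitElt]
  apply orbitStar_eq_of_orbitProductSet_eq
  ext ⟨f, f'⟩
  constructor
  · rintro ⟨x, h1, h2⟩
    obtain rfl : f = x := (mem_orbit_coordFlag_id_iff.1 h1).1
    exact h2
  · exact fun h1 => ⟨f, mem_orbit_coordFlag_id_iff.2 ⟨rfl, h (f, f') h1⟩, h1⟩

theorem orbitElt_mul_kOne {A : FlagPairOrbit k n n}
    (h : ∀ p ∈ A.orbit, p.2.IsComplete) : orbitElt A * kOne k n = orbitElt A := by
  rw [kOne, orbitElt_mul_orbitElt]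
  apply orbitStar_eq_of_orbitProductSet_eq
  ext ⟨f, f'⟩
  constructor
  · rintro ⟨x, h1, h2⟩
    obtain rfl : x = f' := (mem_orbit_coordFlag_id_iff.1 h2).1
    exact h1
  · exact fun h1 => ⟨f', h1, mem_orbit_coordFlag_id_iff.2 ⟨rfl, h (f, f') h1⟩⟩

/-- Completeness is constant along an orbit, so a single composable pair would make all first
components complete. -/
theorem kOne_mul_orbitElt_eq_zero {A : FlagPairOrbit k n n}
    (h : ¬ ∀ p ∈ A.orbit, p.1.IsComplete) : kOne k n * orbitElt A = 0 := by
  rw [kOne, orbitElt_mul_orbitElt]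
  apply orbitStar_eq_zero
  rw [Set.eq_empty_iff_forall_notMem]
  rintro ⟨f, f'⟩ ⟨x, h1, h2⟩
  obtain ⟨h3, h4⟩ := mem_orbit_coordFlag_id_iff.1 h1
  obtain rfl : f = x := h3
  apply h
  intro p hp
  obtain ⟨g, rfl⟩ := exists_smul_of_mem_orbit h2 hp
  exact (StepFlag.isComplete_smul_iff g _).2 h4

theorem orbitElt_mul_kOne_eq_zero {A : FlagPairOrbit k n n}
    (h : ¬ ∀ p ∈ A.orbit, p.2.IsComplete) : orbitElt A * kOne k n = 0 := by
  rw [kOne, orbitElt_mul_orbitElt]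
  apply orbitStar_eq_zero
  rw [Set.eq_empty_iff_forall_notMem]
  rintro ⟨f, f'⟩ ⟨x, h1, h2⟩
  obtain ⟨h3, h4⟩ := mem_orbit_coordFlag_id_iff.1 h2
  obtain rfl : x = f' := h3
  apply h
  intro p hp
  obtain ⟨g, rfl⟩ := exists_smul_of_mem_orbit h1 hp
  exact (StepFlag.isComplete_smul_iff g _).2 h4

theorem kOne_mul_permOrbit (σ : Equiv.Perm (Fin n)) :
    kOne k n * permOrbit k σ = permOrbit k σ :=
  kOne_mul_orbitElt fun p hp => (isCompleteOrbit_perm σ p hp).1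

theorem permOrbit_mul_kOne (σ : Equiv.Perm (Fin n)) :
    permOrbit k σ * kOne k n = permOrbit k σ :=
  orbitElt_mul_kOne fun p hp => (isCompleteOrbit_perm σ p hp).2

theorem span_range_orbitElt {r : ℕ} :
    Submodule.span ℤ (Set.range (orbitElt : FlagPairOrbit k n r → GenericAlgebra k n r)) = ⊤ :=
  (Finsupp.basisSingleOne (R := ℤ) (ι := FlagPairOrbit k n r)).span_eq

/-- Multiplying on both sides by `k_d` keeps the orbits of pairs of complete flags and kills all
others; the survivors are the permutation orbits by Bruhat. -/
theorem zeroHecke_eq_span :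
    zeroHecke k n = Submodule.span ℤ (Set.range (permOrbit k)) := by
  apply le_antisymm
  · rw [zeroHecke, corner, LinearMap.range_eq_map, ← span_range_orbitElt, Submodule.map_span_le]
    rintro _ ⟨A, rfl⟩
    change kOne k n * orbitElt A * kOne k n ∈ _
    by_cases h1 : ∀ p ∈ A.orbit, p.1.IsComplete
    · rw [kOne_mul_orbitElt h1]
      by_cases h2 : ∀ p ∈ A.orbit, p.2.IsComplete
      · rw [orbitElt_mul_kOne h2]
        obtain ⟨σ, hσ⟩ := IsCompleteOrbit.exists_perm fun p hp => ⟨h1 p hp, h2 p hp⟩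
        exact Submodule.subset_span ⟨σ, hσ.symm⟩
      · rw [orbitElt_mul_kOne_eq_zero h2]
        exact zero_mem _
    · rw [kOne_mul_orbitElt_eq_zero h1, zero_mul]
      exact zero_mem _
  · rw [Submodule.span_le]
    rintro _ ⟨σ, rfl⟩
    refine ⟨permOrbit k σ, ?_⟩
    change kOne k n * permOrbit k σ * kOne k n = _
    rw [kOne_mul_permOrbit, permOrbit_mul_kOne]

theorem linearIndependent_permOrbit :
    LinearIndependent ℤ (permOrbit k : Equiv.Perm (Fin n) → GenericAlgebra k n n) := by
  have h := (Finsupp.basisSingleOne (R := ℤ) (ι := FlagPairOrbit k n n)).linearIndependent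
  refine h.comp (fun σ : Equiv.Perm (Fin n) => flagPairOrbit (coordFlag σ) (coordFlag id)) ?_
  intro σ τ hστ
  exact permOrbit_injective (k := k) (congrArg orbitElt hστ)

/-- Everything is multilinear, so it suffices to check the permutation orbits. -/
theorem isUnitalAssocAlgebra_zeroHecke [Infinite k] :
    IsUnitalAssocAlgebra (zeroHecke k n) (kOne k n) := by
  have hmem : ∀ σ, permOrbit k σ ∈ zeroHecke k n := fun σ => by
    rw [zeroHecke_eq_span]
    exact Submodule.subset_span ⟨σ, rfl⟩
  refine ⟨kOne_eq_permOrbit (k := k) (n := n) ▸ hmem 1, fun x hx y hy => ?_, fun x hx => ?_,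
    fun x hx => ?_, fun x hx y hy z hz => ?_⟩
  · rw [zeroHecke_eq_span] at hx hy
    induction hx, hy using Submodule.span_induction₂ with
    | mem_mem x y hx hy =>
      obtain ⟨σ, rfl⟩ := hx
      obtain ⟨τ, rfl⟩ := hy
      obtain ⟨ρ, hρ⟩ := exists_permOrbit_mul (k := k) σ τ
      rw [hρ]
      exact hmem ρ
    | zero_left y _ => rw [zero_mul]; exact zero_mem _
    | zero_right x _ => rw [mul_zero]; exact zero_mem _
    | add_left x y z _ _ _ h1 h2 => rw [add_mul]; exact add_mem h1 h2
    | add_right x y z _ _ _ h1 h2 => rw [mul_add]; exact add_mem h1 h2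
    | smul_left c x y _ _ h => rw [smul_mul_assoc]; exact Submodule.smul_mem _ c h
    | smul_right c x y _ _ h => rw [mul_smul_comm]; exact Submodule.smul_mem _ c h
  · rw [zeroHecke_eq_span] at hx
    induction hx using Submodule.span_induction with
    | mem x hx => obtain ⟨σ, rfl⟩ := hx; exact kOne_mul_permOrbit σ
    | zero => rw [mul_zero]
    | add x y _ _ h1 h2 => rw [mul_add, h1, h2]
    | smul c x _ h => rw [mul_smul_comm, h]
  · rw [zeroHecke_eq_span] at hx
    induction hx using Submodule.span_induction with
    | mem x hx => obtain ⟨σ, rfl⟩ := hx; exact permOrbit_mul_kOne σ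
    | zero => rw [zero_mul]
    | add x y _ _ h1 h2 => rw [add_mul, h1, h2]
    | smul c x _ h => rw [smul_mul_assoc, h]
  · rw [zeroHecke_eq_span] at hx hy hz
    induction hx using Submodule.span_induction with
    | mem x hx =>
      obtain ⟨ρ, rfl⟩ := hx
      induction hy using Submodule.span_induction with
      | mem y hy =>
        obtain ⟨σ, rfl⟩ := hy
        induction hz using Submodule.span_induction with
        | mem z hz =>
          obtain ⟨τ, rfl⟩ := hz
          exact permOrbit_mul_assoc ρ σ τ
        | zero => simp only [mul_zero]
        | add x y _ _ h1 h2 => simp only [mul_add, h1, h2]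
        | smul c x _ h => simp only [mul_smul_comm, h]
      | zero => simp only [mul_zero, zero_mul]
      | add x y _ _ h1 h2 => simp only [mul_add, add_mul, h1, h2]
      | smul c x _ h => simp only [mul_smul_comm, smul_mul_assoc, h]
    | zero => simp only [zero_mul]
    | add x y _ _ h1 h2 => simp only [add_mul, h1, h2]
    | smul c x _ h => simp only [smul_mul_assoc, h]

end CompleteOrbits

/-! ### Simple reflections and the computation of `t^σ` -/

section Generators

variable {k : Type*} [Field k] {n : ℕ}

/-- The permutation matrix `e_l ↦ e_{τ⁻¹ l}` carries the pair for `(σ, id)` to the pair for `(σ * τ,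
τ)`. -/
theorem coordFlag_mul_mem_orbit (σ τ : Equiv.Perm (Fin n)) :
    ((coordFlag (σ * τ : Equiv.Perm (Fin n)), coordFlag τ) : StepFlag k n n × StepFlag k n n) ∈
      (flagPairOrbit (coordFlag σ) (coordFlag id) : FlagPairOrbit k n n).orbit := by
  obtain ⟨g, hg⟩ := exists_GL_single
    ((Pi.basisFun k (Fin n)).linearIndependent.comp (τ⁻¹ : Equiv.Perm (Fin n)) τ⁻¹.injective)
  rw [mem_orbit_flagPairOrbit]
  refine ⟨g, Prod.ext (smul_coordFlag_eq (isComplete_coordFlag _) σ fun l i hl => ?_).symm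
    (smul_coordFlag_eq (isComplete_coordFlag _) 1 fun l i hl => ?_).symm⟩
  · rw [hg]
    exact Submodule.subset_span ⟨τ⁻¹ l, by simpa using hl, by simp⟩
  · rw [hg]
    exact Submodule.subset_span ⟨τ⁻¹ l, by simpa using hl, by simp⟩

/-- The labels `i` and `i + 1` are separated only by the bound `a = i + 1`, so a simple reflection
changes this one step of the flag. -/
theorem coordFlag_swap_space {i j : Fin n} (h : (j : ℕ) = i + 1) {a : Fin (n + 1)}
    (ha : (a : ℕ) ≠ j) :
    (coordFlag (Equiv.swap i j) : StepFlag k n n).space a = (coordFlag id).space a := by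
  ext v
  rw [mem_coordFlag_space, mem_coordFlag_space]
  refine forall₂_congr fun l _ => ?_
  rw [Equiv.swap_apply_def, id]
  split_ifs with h1 h2
  · rw [h1]; omega
  · rw [h2]; omega
  · rfl

theorem finrank_inf_le_add_one {V : Type*} [AddCommGroup V] [Module k V] [FiniteDimensional k V]
    {A B : Submodule k V} (hAB : A ≤ B) (h : Module.finrank k B ≤ Module.finrank k A + 1)
    (W : Submodule k V) : Module.finrank k ↥(B ⊓ W) ≤ Module.finrank k ↥(A ⊓ W) + 1 := by
  have h1 := Submodule.finrank_sup_add_finrank_inf_eq A (B ⊓ W)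
  have h2 : A ⊓ (B ⊓ W) = A ⊓ W := by rw [← inf_assoc, inf_eq_left.2 hAB]
  have h3 := Submodule.finrank_mono (sup_le hAB (inf_le_left : B ⊓ W ≤ B))
  rw [h2] at h1
  omega

/-- Multiplication by a simple reflection that increases the length. -/
theorem permOrbit_swap_mul [Infinite k] {i j : Fin n} (h : (j : ℕ) = i + 1)
    (w : Equiv.Perm (Fin n)) (hw : w⁻¹ i < w⁻¹ j) :
    permOrbit k (Equiv.swap i j) * permOrbit k w = permOrbit k (Equiv.swap i j * w) := by
  refine orbitElt_mul_eq_of_minimal (isCompleteOrbit_perm _) (isCompleteOrbit_perm _)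
    (p := (coordFlag (Equiv.swap i j * w : Equiv.Perm (Fin n)), coordFlag id))
    ⟨coordFlag w, coordFlag_mul_mem_orbit _ _, mem_orbit_iff_flagPairOrbit_eq.2 rfl⟩ ?_
  rintro ⟨f, f'⟩ ⟨x, hfx, hxf⟩ a b
  have hrank := flagRank_eq_of_mem_orbit hxf (mem_orbit_iff_flagPairOrbit_eq.2 rfl)
  have hx := (isCompleteOrbit_perm _ _ hfx)
  -- Translating the standard pair shows that `f` and `x` can differ only at step `j`, so only that
  -- row of the relative position needs an estimate.
  have hspace : ∀ a : Fin (n + 1), (a : ℕ) ≠ j → f.space a = x.space a := by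
    intro a ha
    obtain ⟨g, hg⟩ := mem_orbit_flagPairOrbit.1 hfx
    obtain ⟨rfl, rfl⟩ := Prod.mk.inj hg
    rw [StepFlag.smul_space, StepFlag.smul_space, coordFlag_swap_space h ha]
  have hcard : ∀ (σ : Equiv.Perm (Fin n)) (a b : Fin (n + 1)),
      flagRank ((coordFlag σ, coordFlag id) : StepFlag k n n × StepFlag k n n) a b =
        (Finset.univ.filter fun l : Fin n => (σ l : ℕ) < a ∧ (l : ℕ) < b).card :=
    fun σ a b => flagRank_coordFlag σ 1 a b
  have hwi : ∀ l, w l = i ↔ l = w⁻¹ i := fun l => by rw [Equiv.Perm.eq_inv_iff_eq]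
  have hwj : ∀ l, w l = j ↔ l = w⁻¹ j := fun l => by rw [Equiv.Perm.eq_inv_iff_eq]
  have hval : ∀ l, ((Equiv.swap i j * w) l : ℕ) =
      if l = w⁻¹ i then (j : ℕ) else if l = w⁻¹ j then (i : ℕ) else w l := by
    intro l
    rw [Equiv.Perm.mul_apply, Equiv.swap_apply_def]
    simp only [← hwi, ← hwj]
    split_ifs <;> rfl
  have hwi' : ∀ l, (w l : ℕ) = i ↔ l = w⁻¹ i := fun l => by rw [← hwi, Fin.ext_iff]
  have hwj' : ∀ l, (w l : ℕ) = j ↔ l = w⁻¹ j := fun l => by rw [← hwj, Fin.ext_iff]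
  by_cases ha : (a : ℕ) = j
  · have hjn : (j : ℕ) + 1 < n + 1 := by omega
    by_cases hb : (w⁻¹ j : ℕ) < b
    · have h1 : flagRank ((coordFlag (Equiv.swap i j * w : Equiv.Perm (Fin n)), coordFlag id) :
          StepFlag k n n × StepFlag k n n) a b <
          flagRank ((coordFlag w, coordFlag id) : StepFlag k n n × StepFlag k n n)
            ⟨j + 1, hjn⟩ b := by
        rw [hcard, hcard]
        apply Finset.card_lt_card
        rw [Finset.ssubset_iff_of_subset]
        · refine ⟨w⁻¹ i, ?_, ?_⟩
          · simp only [Finset.mem_filter, Finset.mem_univ, true_and]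
            have := (hwi' (w⁻¹ i)).2 rfl
            have := Fin.lt_def.1 hw
            omega
          · simp only [Finset.mem_filter, Finset.mem_univ, true_and, hval, if_true]
            omega
        · intro l
          simp only [Finset.mem_filter, Finset.mem_univ, true_and, hval]
          have := hwi' l
          have := hwj' l
          split_ifs <;> omega
      have h2 : flagRank (x, f') ⟨j + 1, hjn⟩ b ≤ flagRank (f, f') a b + 1 := by
        unfold flagRank
        simp only
        rw [← hspace _ (by simp)]
        apply finrank_inf_le_add_one
        · exact f.mono' (Fin.le_def.2 (by simp [ha]))
        · rw [hx.1, hx.1, ha]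
      rw [hrank] at h2
      exact Nat.le_of_lt_succ (h1.trans_le h2)
    · have h1 : flagRank ((coordFlag (Equiv.swap i j * w : Equiv.Perm (Fin n)), coordFlag id) :
          StepFlag k n n × StepFlag k n n) a b ≤
          flagRank ((coordFlag w, coordFlag id) : StepFlag k n n × StepFlag k n n)
            i.castSucc b := by
        rw [hcard, hcard]
        apply Finset.card_le_card
        intro l
        simp only [Finset.mem_filter, Finset.mem_univ, true_and, hval, Fin.val_castSucc]
        have := hwi' l
        have := hwj' l
        have : l = w⁻¹ j → (l : ℕ) = (w⁻¹ j : Fin n) := fun h => by rw [h]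
        split_ifs <;> omega
      have h2 : flagRank (x, f') i.castSucc b ≤ flagRank (f, f') a b := by
        unfold flagRank
        simp only
        rw [← hspace _ (by rw [Fin.val_castSucc]; omega)]
        exact Submodule.finrank_mono (inf_le_inf_right _
          (f.mono' (Fin.le_def.2 (by rw [Fin.val_castSucc]; omega))))
      rw [hrank] at h2
      exact h1.trans h2
  · have h1 : flagRank (f, f') a b = flagRank (x, f') a b := by
      change Module.finrank k ↥(f.space a ⊓ f'.space b) = _
      rw [hspace a ha]
      rfl
    rw [h1, hrank, hcard, hcard]
    apply Finset.card_le_card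
    intro l
    simp only [Finset.mem_filter, Finset.mem_univ, true_and, hval]
    have := hwi' l
    have := hwj' l
    split_ifs <;> omega

theorem tGen_eq {i j : Fin n} (h : (j : ℕ) = i + 1) :
    tGen k n i = permOrbit k (Equiv.swap i j) := by
  rw [tGen, dif_pos (by omega)]
  congr 2
  exact Fin.ext h.symm

theorem tInterval_self (i : ℕ) : tInterval k n i i = kOne k n := by
  simp [tInterval]

theorem tInterval_of_lt {i j : ℕ} (h : i < j) :
    tInterval k n i j = tGen k n i * tInterval k n (i + 1) j := by
  have : j - i = (j - (i + 1)) + 1 := by omega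
  rw [tInterval, this, List.range'_succ]
  rfl

/-- Associativity is available only for permutation orbits, so the interval product has to be
recognised as one. -/
theorem exists_tInterval_eq [Infinite k] (i d : ℕ) (h : i + d < n) :
    ∃ ρ, tInterval k n i (i + d) = permOrbit k ρ := by
  induction d generalizing i with
  | zero => exact ⟨1, tInterval_self i⟩
  | succ d ih =>
    obtain ⟨ρ, hρ⟩ := ih (i + 1) (by omega)
    rw [tInterval_of_lt (by omega), show i + (d + 1) = i + 1 + d by omega, hρ,
      tGen_eq (i := ⟨i, by omega⟩) (j := ⟨i + 1, by omega⟩) rfl]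
    exact exists_permOrbit_mul _ _

/-- Left multiplication by `tᵢ ⋆ ⋯ ⋆ tₘ₋₁` moves the value `m` down to `i`. -/
theorem tInterval_mul_permOrbit [Infinite k] (d : ℕ) {i : ℕ} (w : Equiv.Perm (Fin n)) {c : Fin n}
    (hc : (w c : ℕ) = i + d) (hw : ∀ l, i ≤ (w l : ℕ) → (w l : ℕ) < w c → l < c) :
    ∃ w', tInterval k n i (i + d) * permOrbit k w = permOrbit k w' ∧ ∀ l, (w' l : ℕ) =
      if l = c then i else if i ≤ (w l : ℕ) ∧ (w l : ℕ) < w c then (w l : ℕ) + 1 else w l := by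
  induction d generalizing i with
  | zero =>
    refine ⟨w, by rw [Nat.add_zero, tInterval_self, kOne_mul_permOrbit], fun l => ?_⟩
    split_ifs with h1 h2
    · rw [h1]; omega
    · omega
    · rfl
  | succ d ih =>
    -- The tail of the product acts first and brings the value at `c` down to `i + 1`; then `tᵢ`
    -- exchanges it with the value `i`.
    obtain ⟨w₁, hw₁, hval⟩ := ih (i := i + 1) (by omega) (fun l h1 h2 => hw l (by omega) h2)
    have hcn := (w c).2
    obtain ⟨ρ, hρ⟩ := exists_tInterval_eq (k := k) (n := n) (i + 1) d (by omega)
    let a : Fin n := ⟨i, by omega⟩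
    let b : Fin n := ⟨i + 1, by omega⟩
    have hac : w (w⁻¹ a) = a := by simp
    have hac' : (w (w⁻¹ a) : ℕ) = i := congrArg Fin.val hac
    -- The value `i` has not moved and stands to the left of `c`, so the last swap increases the
    -- length.
    have hlt : w⁻¹ a < c := hw _ (by omega) (by omega)
    have h1 : w₁ c = b := Fin.ext (by rw [hval, if_pos rfl])
    have h2 : w₁ (w⁻¹ a) = a := Fin.ext (by
      rw [hval, if_neg hlt.ne, if_neg (by omega), hac'])
    have hbin : w₁⁻¹ b = c := by rw [Equiv.Perm.inv_eq_iff_eq, h1]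
    have hain : w₁⁻¹ a = w⁻¹ a := by rw [Equiv.Perm.inv_eq_iff_eq, h2]
    refine ⟨Equiv.swap a b * w₁, ?_, fun l => ?_⟩
    · rw [tInterval_of_lt (by omega), show i + (d + 1) = i + 1 + d by omega, hρ,
        tGen_eq (i := a) (j := b) rfl, permOrbit_mul_assoc, ← hρ, hw₁]
      exact permOrbit_swap_mul rfl w₁ (by rwa [hbin, hain])
    · have hl := hval l
      rw [Equiv.Perm.mul_apply, Equiv.swap_apply_def]
      have ea : w₁ l = a ↔ l = w⁻¹ a := by rw [← hain, Equiv.Perm.eq_inv_iff_eq]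
      have eb : w₁ l = b ↔ l = c := by rw [← hbin, Equiv.Perm.eq_inv_iff_eq]
      by_cases hlc : l = c
      · have hne : w₁ l ≠ a := fun h => by
          rw [ea, hlc] at h
          exact hlt.ne h.symm
        rw [if_neg hne, if_pos (eb.2 hlc), if_pos hlc]
      · rw [if_neg hlc] at hl
        rw [if_neg hlc]
        by_cases hla : l = w⁻¹ a
        · rw [if_pos (ea.2 hla), hla, hac', if_pos (by omega)]
        · have hne : (w l : ℕ) ≠ i := fun h => hla (by
            rw [Equiv.Perm.eq_inv_iff_eq]
            exact Fin.ext h)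
          rw [if_neg (mt ea.1 hla), if_neg (mt eb.1 hlc), hl]
          split_ifs <;> omega

theorem permOf_permOrbit (τ : Equiv.Perm (Fin n)) : permOf (permOrbit k τ) = τ := by
  have h : ∃ ρ, permOrbit k ρ = permOrbit k τ := ⟨τ, rfl⟩
  rw [permOf, dif_pos h]
  exact permOrbit_injective h.choose_spec

/-- The partial product `t^{σ,i} ⋆ ⋯ ⋆ t^{σ,1}` is given by the permutation that agrees with `σ`
where `σ` takes one of the first `i` values, and is increasing elsewhere. -/
theorem exists_tPartial_eq [Infinite k] (σ : Equiv.Perm (Fin n)) (i : ℕ) (hi : i ≤ n) :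
    ∃ τ, permOrbit k τ = tPartial k σ i ∧ (∀ l, (σ l : ℕ) < i → τ l = σ l) ∧
      (∀ l, i ≤ (σ l : ℕ) → i ≤ (τ l : ℕ)) ∧
      ∀ l l', i ≤ (σ l : ℕ) → i ≤ (σ l' : ℕ) → l < l' → τ l < τ l' := by
  induction i with
  | zero =>
    exact ⟨1, rfl, fun l h => absurd h (Nat.not_lt_zero _), fun _ _ => Nat.zero_le _,
      fun _ _ _ _ h => h⟩
  | succ i ih =>
    obtain ⟨τ, hτ, h1, h2, h3⟩ := ih (by omega)
    have hin : i < n := hi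
    let c := σ⁻¹ ⟨i, hin⟩
    have hσc : (σ c : ℕ) = i := by simp [c]
    have hne : ∀ l, l ≠ c → (σ l : ℕ) ≠ i := fun l hl h => hl (by
      rw [Equiv.Perm.eq_inv_iff_eq]
      exact Fin.ext h)
    have hτne : ∀ l, l ≠ c → (τ l : ℕ) ≠ τ c := fun l hl h => hl (τ.injective (Fin.ext h))
    have hic : i ≤ (τ c : ℕ) := h2 c hσc.ge
    have hlow : ∀ l, i ≤ (τ l : ℕ) → i ≤ (σ l : ℕ) := by
      intro l hl
      by_contra h
      rw [h1 l (by omega)] at hl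
      exact h hl
    -- Values of `τ` in `[i, τ c)` sit at positions that `σ` has not yet treated, where `τ` is
    -- increasing; hence they stand to the left of `c`, as the sliding lemma requires.
    obtain ⟨w, hw, hval⟩ := tInterval_mul_permOrbit (k := k) ((τ c : ℕ) - i) (i := i) τ (c := c)
      (by omega) (by
        intro l hl hlc
        by_contra hcl
        rcases (not_lt.1 hcl).eq_or_lt with h | h
        · rw [h] at hlc
          exact lt_irrefl _ hlc
        · exact absurd (Fin.lt_def.1 (h3 c l hσc.ge (hlow l hl) h)) hlc.not_gt)
    refine ⟨w, ?_, fun l hl => Fin.ext ?_, fun l hl => ?_, fun l l' hl hl' hll => Fin.lt_def.2 ?_⟩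
    · rw [tPartial, dif_pos hin, ← hτ, permOf_permOrbit, ← hw]
      congr 2
      change _ = (τ c : ℕ)
      omega
    · rw [hval]
      by_cases hlc : l = c
      · rw [if_pos hlc, hlc, hσc]
      · have := hne l hlc
        have e := h1 l (by omega)
        rw [if_neg hlc, e, if_neg (by omega)]
    · have hlc : l ≠ c := by
        rintro rfl
        omega
      have := h2 l (by omega)
      have := hτne l hlc
      rw [hval, if_neg hlc]
      split_ifs <;> omega
    · have hlc : l ≠ c := by
        rintro rfl
        omega
      have hlc' : l' ≠ c := by
        rintro rfl
        omega
      have := hτne l hlc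
      have := hτne l' hlc'
      have := h2 l (by omega)
      have := h2 l' (by omega)
      have := Fin.lt_def.1 (h3 l l' (by omega) (by omega) hll)
      rw [hval, hval, if_neg hlc, if_neg hlc']
      split_ifs <;> omega

theorem tPerm_eq_permOrbit [Infinite k] (σ : Equiv.Perm (Fin n)) :
    tPerm k σ = permOrbit k σ := by
  -- At stage `n` every value of `σ` has been placed, so agreement on the placed positions is
  -- equality.
  obtain ⟨τ, hτ, h, -⟩ := exists_tPartial_eq (k := k) σ n le_rfl
  rw [tPerm, ← hτ]
  congr 1
  ext l
  rw [h l (σ l).2]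

end Generators

theorem theorem10p3 (k : Type*) [Field k] [IsAlgClosed k] (n : ℕ) :
    -- `H₀(n)` is an associative ring with identity `k_d`
    IsUnitalAssocAlgebra (zeroHecke k n) (kOne k n) ∧
    -- the permutations `τᵢ` used to form `t^σ` are well defined
    (∀ σ : Equiv.Perm (Fin n), ∀ i ≤ n,
      ∃! τ : Equiv.Perm (Fin n), permOrbit k τ = tPartial k σ i) ∧
    (∀ σ : Equiv.Perm (Fin n), tPerm k σ = permOrbit k σ) ∧
    IsMultiplicativeBasis (zeroHecke k n) (fun σ : Equiv.Perm (Fin n) => tPerm k σ) := by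
  have : Infinite k := IsAlgClosed.instInfinite
  refine ⟨isUnitalAssocAlgebra_zeroHecke, fun σ i hi => ?_, tPerm_eq_permOrbit, ?_⟩
  · obtain ⟨τ, hτ, -⟩ := exists_tPartial_eq (k := k) σ i hi
    exact ⟨τ, hτ, fun τ' hτ' => permOrbit_injective (hτ'.trans hτ.symm)⟩
  · simp only [tPerm_eq_permOrbit]
    exact ⟨linearIndependent_permOrbit, zeroHecke_eq_span.symm,
      fun σ τ => Or.inr (exists_permOrbit_mul σ τ)⟩
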